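/- A skew lattice is a set with associative idempotent operations $\land,\lor$ satisfying $x\land(x\lor y)=x=(y\lor x)\land x$ and $x\lor(x\land y)=x=(y\land x)\lor x$. Write $x\le y$ if $x\land y=y\land x=x$, and $x\preceq y$ if $x\land y\land x=x$. A skew algebra (skew Boolean algebra with intersections) is a skew lattice in which $\land$ distributes over $\lor$ on both sides, with an element $0$ that is neutral for $\lor$, an operation $\setminus$ such that $(x\setminus y)\land(x\land y\land x)=0$ and $(x\setminus y)\lor(x\land y\land x)=x$, and an operation $\cap$ giving greatest lower bounds with respect to $\le$. It is right-handed if $x\land y\land x=y\land x$ for all $x,y$. Homomorphisms preserve $0,\land,\lor,\setminus,\cap$. An ideal is a subset containing $0$, closed under $\lor$ and downward closed for $\preceq$. A homomorphism $f:A\to A'$ is $\preceq$-cofinal if the ideal of $A'$ generated by $f(A)$ is $A'$. A skew Boolean space is a surjective étale map (local homeomorphism) $p:E\to B$ between Boolean spaces, that is, locally compact Hausdorff spaces in which the clopen sets form a base. A morphism from $p:E\to B$ to $p':E'\to B'$ is a pair $(g,h)$ of proper continuous partial maps with open domains, $g:E\rightharpoonup E'$ and $h:B\rightharpoonup B'$,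 such that for every $e\in\operatorname{dom} g$ one has $p(e)\in\operatorname{dom} h$ and $p'(g(e))=h(p(e))$, and such that for every $x\in\operatorname{dom} h$ the map $g$ restricts to a bijection from $E_x\cap\operatorname{dom} g$ onto $E'_{h(x)}$. The morphism is semitotal if $h$ is total. A copen section of $p$ is a compact open $S\subseteq E$ on which $p$ is injective. With $\sigma_p(S)=p^{-1}(p(S))$, the copen sections of $p$ form a right-handed skew algebra $A_p$ under $$0=\emptyset,\quad S\land R=\sigma_p(S)\cap R,\quad S\lor R=S\cup(R-\sigma_p(S)),\quad S\setminus R=S-\sigma_p(R),\quad S\cap R=S\cap R.$$ Let $\mathcal A$ be the contravariant functor $p\mapsto A_p$, $(g,h)\mapsto\bigl(S\mapsto g^{-1}(S)\bigr)$ from skew Boolean spaces and their morphisms to right-handed skew algebras and homomorphisms. Theorem. The functor $\mathcal A$ is a dual equivalence of categories. It restricts to a dual equivalence between the category of skew Boolean spaces and semitotal morphisms and the category of right-handed skew algebras and $\preceq$-cofinal homomorphisms. More precisely, let $\mathcal A$ be completed in any way to an equivalence with quasi-inverse $\mathcal S$. Then a morphism $(g,h)$ is semitotal if and only if $\mathcal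 A(g,h)$ is $\preceq$-cofinal, a homomorphism $f$ is $\preceq$-cofinal if and only if $\mathcal S(f)$ is semitotal, and the restrictions of $\mathcal A$ and $\mathcal S$ to these two categories, which have all objects, are the two functors of a dual equivalence between them. Moreover, a homomorphism $f:A\to A'$ of right-handed skew algebras is $\preceq$-cofinal if and only if for every $y\in A'$ there is $x\in A$ with $y\preceq f(x)$. -/

import Mathlib

universe u

open CategoryTheory Opposite

namespace SkewDuality

/-! ## Skew algebras -/

/-- A skew lattice: `⊓` and `⊔` are the (noncommutative) meet and join. -/
class SkewLattice (A : Type u) extends Min A, Max A where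
  meet_idem : ∀ x : A, x ⊓ x = x
  join_idem : ∀ x : A, x ⊔ x = x
  meet_assoc : ∀ x y z : A, (x ⊓ y) ⊓ z = x ⊓ (y ⊓ z)
  join_assoc : ∀ x y z : A, (x ⊔ y) ⊔ z = x ⊔ (y ⊔ z)
  meet_join_absorb : ∀ x y : A, x ⊓ (x ⊔ y) = x
  join_meet_absorb' : ∀ x y : A, (y ⊔ x) ⊓ x = x
  join_meet_absorb : ∀ x y : A, x ⊔ (x ⊓ y) = x
  meet_join_absorb' : ∀ x y : A, (y ⊓ x) ⊔ x = x

/-- The natural partial order `x ≤ y`. -/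
def NatLE {A : Type u} [SkewLattice A] (x y : A) : Prop :=
  x ⊓ y = x ∧ y ⊓ x = x

/-- The natural preorder `x ⪯ y`. -/
def NatPre {A : Type u} [SkewLattice A] (x y : A) : Prop :=
  x ⊓ y ⊓ x = x

/-- A skew Boolean algebra: a meet-distributive skew lattice with zero and relative complement. -/
class SkewBooleanAlgebra (A : Type u) extends SkewLattice A, Zero A, SDiff A where
  meet_join_distrib : ∀ x y z : A, x ⊓ (y ⊔ z) = (x ⊓ y) ⊔ (x ⊓ z)
  join_meet_distrib : ∀ x y z : A, (y ⊔ z) ⊓ x = (y ⊓ x) ⊔ (z ⊓ x)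
  zero_join : ∀ x : A, 0 ⊔ x = x
  join_zero : ∀ x : A, x ⊔ 0 = x
  sdiff_meet : ∀ x y : A, (x \ y) ⊓ (x ⊓ y ⊓ x) = 0
  sdiff_join : ∀ x y : A, (x \ y) ⊔ (x ⊓ y ⊓ x) = x

/-- A skew algebra (skew Boolean intersection algebra): any two elements have a greatest lower
bound `x ∩ y` with respect to the natural partial order. -/
class SkewAlgebra (A : Type u) extends SkewBooleanAlgebra A, Inter A where
  inter_le_left : ∀ x y : A, NatLE (x ∩ y) x
  inter_le_right : ∀ x y : A, NatLE (x ∩ y) y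
  le_inter : ∀ x y z : A, NatLE z x → NatLE z y → NatLE z (x ∩ y)

/-- Right-handedness. -/
class RightHanded (A : Type u) [SkewLattice A] : Prop where
  right_handed : ∀ x y : A, x ⊓ y ⊓ x = y ⊓ x

/-- A homomorphism of skew algebras preserves all the operations. -/
@[ext]
structure SkewHom (A A' : Type u) [SkewAlgebra A] [SkewAlgebra A'] where
  toFun : A → A'
  map_zero : toFun 0 = 0
  map_meet : ∀ x y, toFun (x ⊓ y) = toFun x ⊓ toFun y
  map_join : ∀ x y, toFun (x ⊔ y) = toFun x ⊔ toFun y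
  map_sdiff : ∀ x y, toFun (x \ y) = toFun x \ toFun y
  map_inter : ∀ x y, toFun (x ∩ y) = toFun x ∩ toFun y

/-- A right-handed skew algebra, as an object of a category. -/
structure RightSkewAlg : Type (u + 1) where
  carrier : Type u
  [skewAlgebra : SkewAlgebra carrier]
  [rightHanded : RightHanded carrier]

attribute [instance] RightSkewAlg.skewAlgebra RightSkewAlg.rightHanded

/-- The category of right-handed skew algebras and all homomorphisms. -/
instance : Category.{u} RightSkewAlg.{u} where
  Hom A A' := SkewHom A.carrier A'.carrier
  id A := ⟨id, rfl, fun _ _ => rfl, fun _ _ => rfl, fun _ _ => rfl, fun _ _ => rfl⟩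
  comp f g :=
    { toFun := g.toFun ∘ f.toFun
      map_zero := by simp [f.map_zero, g.map_zero]
      map_meet := by simp [f.map_meet, g.map_meet]
      map_join := by simp [f.map_join, g.map_join]
      map_sdiff := by simp [f.map_sdiff, g.map_sdiff]
      map_inter := by simp [f.map_inter, g.map_inter] }

/-- The underlying map of a morphism of right-handed skew algebras. -/
def mapOf {A A' : RightSkewAlg.{u}} (f : A ⟶ A') : A.carrier → A'.carrier :=
  SkewHom.toFun f

/-! ## Ideals and cofinal homomorphisms -/

/-- An ideal: lower with respect to `⪯` and closed under finite joins. -/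
structure IsIdeal {A : Type u} [SkewAlgebra A] (I : Set A) : Prop where
  zero_mem : (0 : A) ∈ I
  join_mem : ∀ x y : A, x ∈ I → y ∈ I → x ⊔ y ∈ I
  lower : ∀ x y : A, NatPre x y → y ∈ I → x ∈ I

/-- The ideal generated by a subset. -/
def idealSpan {A : Type u} [SkewAlgebra A] (S : Set A) : Set A :=
  {x | ∀ I : Set A, IsIdeal I → S ⊆ I → x ∈ I}

/-- A subset is `⪯`-cofinal when the ideal it generates is the whole algebra. -/
def PreCofinal {A : Type u} [SkewAlgebra A] (S : Set A) : Prop :=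
  idealSpan S = Set.univ

/-- The `⪯`-cofinal homomorphisms: those with a `⪯`-cofinal image. -/
def preCofinal : MorphismProperty RightSkewAlg.{u} :=
  fun _ _ f => PreCofinal (Set.range (mapOf f))

theorem IsIdeal.preimage {A A' : RightSkewAlg.{u}} (f : A ⟶ A') {I : Set A'.carrier}
    (hI : IsIdeal I) : IsIdeal (mapOf f ⁻¹' I) where
  zero_mem := by
    change SkewHom.toFun f 0 ∈ I
    rw [SkewHom.map_zero]; exact hI.zero_mem
  join_mem x y hx hy := by
    change SkewHom.toFun f (x ⊔ y) ∈ I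
    rw [SkewHom.map_join]; exact hI.join_mem _ _ hx hy
  lower x y h hy := by
    refine hI.lower _ _ ?_ hy
    change SkewHom.toFun f x ⊓ SkewHom.toFun f y ⊓ SkewHom.toFun f x = SkewHom.toFun f x
    rw [← SkewHom.map_meet, ← SkewHom.map_meet]
    exact congrArg _ h

instance : preCofinal.{u}.IsMultiplicative where
  id_mem A := Set.eq_univ_of_forall fun x _ _ h => h ⟨x, rfl⟩
  comp_mem {A B C} f g hf hg := by
    refine Set.eq_univ_of_forall fun z I hI h => ?_
    have h1 : ∀ y, mapOf g y ∈ I := fun y => by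
      have hy : y ∈ idealSpan (Set.range (mapOf f)) := by
        rw [show idealSpan (Set.range (mapOf f)) = Set.univ from hf]; trivial
      refine hy _ (hI.preimage g) ?_
      rintro _ ⟨x, rfl⟩
      exact h ⟨x, rfl⟩
    have hz : z ∈ idealSpan (Set.range (mapOf g)) := by
      rw [show idealSpan (Set.range (mapOf g)) = Set.univ from hg]; trivial
    refine hz _ hI ?_
    rintro _ ⟨y, rfl⟩
    exact h1 y

/-! ## Skew Boolean spaces -/

/-- A Boolean space: a locally compact zero-dimensional Hausdorff space. -/
class BooleanSpace (X : Type u) [TopologicalSpace X] : Prop where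
  locallyCompact : LocallyCompactSpace X
  t2 : T2Space X
  zeroDimensional : TopologicalSpace.IsTopologicalBasis {s : Set X | IsClopen s}

attribute [instance] BooleanSpace.locallyCompact BooleanSpace.t2

/-- A skew Boolean space: a surjective étale map (local homeomorphism) between Boolean spaces. -/
structure SkewBooleanSpace : Type (u + 1) where
  total : Type u
  base : Type u
  [topTotal : TopologicalSpace total]
  [topBase : TopologicalSpace base]
  [booleanTotal : BooleanSpace total]
  [booleanBase : BooleanSpace base]
  proj : total → base
  etale : IsLocalHomeomorph proj
  surj : Function.Surjective proj

attribute [instance] SkewBooleanSpace.topTotal SkewBooleanSpace.topBase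
  SkewBooleanSpace.booleanTotal SkewBooleanSpace.booleanBase

/-- A proper continuous partial map with open domain: preimages of open sets are open (in
particular the domain is open), and preimages of compact sets are compact. -/
structure IsProperPartial {X Y : Type u} [TopologicalSpace X] [TopologicalSpace Y]
    (f : X →. Y) : Prop where
  continuous : PContinuous f
  proper : ∀ K : Set Y, IsCompact K → IsCompact (f.preimage K)

/-- A morphism `(g, h)` of skew Boolean spaces. Here `y ∈ g x` says that `g` is defined at `x`
with value `y`. The square commutes on the domain of `g`: if `g` is defined at `e` then `h` is
defined at `p e`, with value `p' (g e)`. The map `g` is bijective on fibers: if `h` is defined at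
`x`, then every point of the fiber over `h x` is the value of `g` at exactly one point of the
fiber over `x`. -/
@[ext]
structure SpaceHom (X Y : SkewBooleanSpace.{u}) where
  g : X.total →. Y.total
  h : X.base →. Y.base
  g_proper : IsProperPartial g
  h_proper : IsProperPartial h
  comm : ∀ e e', e' ∈ g e → Y.proj e' ∈ h (X.proj e)
  bij : ∀ x x', x' ∈ h x → ∀ e', Y.proj e' = x' → ∃! e, X.proj e = x ∧ e' ∈ g e

theorem IsProperPartial.id (X : Type u) [TopologicalSpace X] :
    IsProperPartial (PFun.id X) where
  continuous s hs := by
    rw [← PFun.coe_id, PFun.coe_preimage]; exact hs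
  proper K hK := by
    rw [← PFun.coe_id, PFun.coe_preimage]; exact hK

theorem IsProperPartial.comp {X Y Z : Type u} [TopologicalSpace X] [TopologicalSpace Y]
    [TopologicalSpace Z] {g : Y →. Z} {f : X →. Y} (hg : IsProperPartial g)
    (hf : IsProperPartial f) : IsProperPartial (g.comp f) where
  continuous s hs := by
    rw [PFun.preimage_comp]; exact hf.continuous _ (hg.continuous _ hs)
  proper K hK := by
    rw [PFun.preimage_comp]; exact hf.proper _ (hg.proper _ hK)

theorem mem_comp {X Y Z : Type u} {g : Y →. Z} {f : X →. Y} {x : X} {z : Z} :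
    z ∈ g.comp f x ↔ ∃ y, y ∈ f x ∧ z ∈ g y :=
  Part.mem_bind_iff

/-- The category of skew Boolean spaces; partial maps are composed on the largest domain. -/
instance : Category.{u} SkewBooleanSpace.{u} where
  Hom X Y := SpaceHom X Y
  id X :=
    { g := PFun.id _
      h := PFun.id _
      g_proper := .id _
      h_proper := .id _
      comm := by
        intro e e' he
        simp only [PFun.id_apply, Part.mem_some_iff] at he ⊢
        rw [he]
      bij := by
        intro x x' hx e' he
        simp only [PFun.id_apply, Part.mem_some_iff] at hx ⊢
        exact ⟨e', ⟨he.trans hx, rfl⟩, fun _ h => h.2.symm⟩ }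
  comp {X Y Z} a b :=
    { g := b.g.comp a.g
      h := b.h.comp a.h
      g_proper := b.g_proper.comp a.g_proper
      h_proper := b.h_proper.comp a.h_proper
      comm := by
        intro e e' he
        obtain ⟨y, hy, hz⟩ := mem_comp.1 he
        exact mem_comp.2 ⟨_, a.comm _ _ hy, b.comm _ _ hz⟩
      bij := by
        intro x x' hx e' he
        obtain ⟨y, hy, hz⟩ := mem_comp.1 hx
        obtain ⟨w, ⟨hw1, hw2⟩, hw3⟩ := b.bij _ _ hz e' he
        obtain ⟨v, ⟨hv1, hv2⟩, hv3⟩ := a.bij _ _ hy w hw1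
        refine ⟨v, ⟨hv1, mem_comp.2 ⟨w, hv2, hw2⟩⟩, ?_⟩
        rintro v' ⟨h1, h2⟩
        obtain ⟨w', h3, h4⟩ := mem_comp.1 h2
        have h5 : Y.proj w' = y := by
          have := a.comm _ _ h3
          rw [h1] at this
          exact Part.mem_unique this hy
        have h6 : w' = w := hw3 w' ⟨h5, h4⟩
        exact hv3 v' ⟨h1, h6 ▸ h3⟩ }
  id_comp a := SpaceHom.ext (PFun.comp_id _) (PFun.comp_id _)
  comp_id a := SpaceHom.ext (PFun.id_comp _) (PFun.id_comp _)
  assoc a b c := SpaceHom.ext (PFun.comp_assoc _ _ _).symm (PFun.comp_assoc _ _ _).symm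

/-- The total part `g` of a morphism `(g, h)`. -/
def upper {X Y : SkewBooleanSpace.{u}} (a : X ⟶ Y) : X.total →. Y.total := SpaceHom.g a

/-- The base part `h` of a morphism `(g, h)`. -/
def lower {X Y : SkewBooleanSpace.{u}} (a : X ⟶ Y) : X.base →. Y.base := SpaceHom.h a

/-- A morphism `(g, h)` is semitotal when `h` is total. -/
def semitotal : MorphismProperty SkewBooleanSpace.{u} :=
  fun _ _ a => (lower a).Dom = Set.univ

instance : semitotal.{u}.IsMultiplicative where
  id_mem X := Set.eq_univ_of_forall fun _ => trivial
  comp_mem {X Y Z} a b ha hb := by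
    change ((lower b).comp (lower a)).Dom = Set.univ
    rw [PFun.dom_comp, show (lower b).Dom = Set.univ from hb, PFun.preimage_univ]
    exact ha

/-! ## The right-handed skew algebra of copen sections -/

/-- A copen section of `p : E → B`: a compact open subset of `E` on which `p` is injective. -/
@[ext]
structure CopenSection (X : SkewBooleanSpace.{u}) where
  carrier : Set X.total
  isOpen : IsOpen carrier
  isCompact : IsCompact carrier
  inj : Set.InjOn X.proj carrier

/-- The saturation of a subset of the total space. -/
def sat (X : SkewBooleanSpace.{u}) (S : Set X.total) : Set X.total :=
  X.proj ⁻¹' (X.proj '' S)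

namespace CopenSection

variable {X Y : SkewBooleanSpace.{u}}

theorem sat_isClopen (S : CopenSection X) : IsClopen (sat X S.carrier) :=
  ⟨(S.isCompact.image X.etale.continuous).isClosed.preimage X.etale.continuous,
    (X.etale.isOpenMap _ S.isOpen).preimage X.etale.continuous⟩

instance : Zero (CopenSection X) := ⟨⟨∅, isOpen_empty, isCompact_empty, Set.injOn_empty _⟩⟩

instance : Min (CopenSection X) where
  min S R :=
    { carrier := sat X S.carrier ∩ R.carrier
      isOpen := S.sat_isClopen.isOpen.inter R.isOpen
      isCompact := R.isCompact.inter_left S.sat_isClopen.isClosed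
      inj := R.inj.mono Set.inter_subset_right }

instance : Max (CopenSection X) where
  max S R :=
    { carrier := S.carrier ∪ (R.carrier \ sat X S.carrier)
      isOpen := S.isOpen.union (R.isOpen.sdiff S.sat_isClopen.isClosed)
      isCompact := S.isCompact.union (R.isCompact.diff S.sat_isClopen.isOpen)
      inj := by
        rintro a (ha | ⟨ha, ha'⟩) b (hb | ⟨hb, hb'⟩) hab
        · exact S.inj ha hb hab
        · exact absurd ⟨a, ha, hab⟩ hb'
        · exact absurd ⟨b, hb, hab.symm⟩ ha'
        · exact R.inj ha hb hab }

instance : SDiff (CopenSection X) where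
  sdiff S R :=
    { carrier := S.carrier \ sat X R.carrier
      isOpen := S.isOpen.sdiff R.sat_isClopen.isClosed
      isCompact := S.isCompact.diff R.sat_isClopen.isOpen
      inj := S.inj.mono Set.sdiff_subset }

instance : Inter (CopenSection X) where
  inter S R :=
    { carrier := S.carrier ∩ R.carrier
      isOpen := S.isOpen.inter R.isOpen
      isCompact := S.isCompact.inter R.isCompact
      inj := S.inj.mono Set.inter_subset_left }

theorem mem_meet {S R : CopenSection X} {e : X.total} :
    e ∈ (S ⊓ R).carrier ↔ e ∈ sat X S.carrier ∧ e ∈ R.carrier := Iff.rfl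

theorem mem_join {S R : CopenSection X} {e : X.total} :
    e ∈ (S ⊔ R).carrier ↔ e ∈ S.carrier ∨ (e ∈ R.carrier ∧ e ∉ sat X S.carrier) := Iff.rfl

theorem mem_sdiff {S R : CopenSection X} {e : X.total} :
    e ∈ (S \ R).carrier ↔ e ∈ S.carrier ∧ e ∉ sat X R.carrier := Iff.rfl

theorem mem_inter {S R : CopenSection X} {e : X.total} :
    e ∈ (S ∩ R).carrier ↔ e ∈ S.carrier ∧ e ∈ R.carrier := Iff.rfl

theorem mem_zero {e : X.total} : e ∈ (0 : CopenSection X).carrier ↔ False := Iff.rfl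

theorem mem_sat {S : Set X.total} {e : X.total} :
    e ∈ sat X S ↔ ∃ s ∈ S, X.proj s = X.proj e := Iff.rfl

theorem subset_sat {S : Set X.total} {e : X.total} (h : e ∈ S) : e ∈ sat X S := ⟨e, h, rfl⟩

theorem sat_congr {S : Set X.total} {e e' : X.total} (h : X.proj e = X.proj e') :
    e ∈ sat X S ↔ e' ∈ sat X S := by
  rw [mem_sat, mem_sat, h]

theorem sat_meet {S R : CopenSection X} {e : X.total} :
    e ∈ sat X (S ⊓ R).carrier ↔ e ∈ sat X S.carrier ∧ e ∈ sat X R.carrier := by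
  constructor
  · rintro ⟨s, ⟨h1, h2⟩, h3⟩
    exact ⟨(sat_congr h3).1 h1, s, h2, h3⟩
  · rintro ⟨h1, s, h2, h3⟩
    exact ⟨s, ⟨(sat_congr h3).2 h1, h2⟩, h3⟩

theorem sat_join {S R : CopenSection X} {e : X.total} :
    e ∈ sat X (S ⊔ R).carrier ↔ e ∈ sat X S.carrier ∨ e ∈ sat X R.carrier := by
  constructor
  · rintro ⟨s, h1 | ⟨h1, h2⟩, h3⟩
    · exact Or.inl ⟨s, h1, h3⟩
    · exact Or.inr ⟨s, h1, h3⟩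
  · intro h
    by_cases hS : e ∈ sat X S.carrier
    · obtain ⟨s, h1, h2⟩ := hS
      exact ⟨s, Or.inl h1, h2⟩
    · obtain ⟨s, h1, h2⟩ := h.resolve_left hS
      exact ⟨s, Or.inr ⟨h1, fun h => hS ((sat_congr h2).1 h)⟩, h2⟩

theorem sat_sdiff {S R : CopenSection X} {e : X.total} :
    e ∈ sat X (S \ R).carrier ↔ e ∈ sat X S.carrier ∧ e ∉ sat X R.carrier := by
  constructor
  · rintro ⟨s, ⟨h1, h2⟩, h3⟩
    exact ⟨⟨s, h1, h3⟩, fun h => h2 ((sat_congr h3).2 h)⟩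
  · rintro ⟨⟨s, h1, h2⟩, h3⟩
    exact ⟨s, ⟨h1, fun h => h3 ((sat_congr h2).1 h)⟩, h2⟩

theorem mem_of_sat_inter {S R : CopenSection X} {e : X.total}
    (h : e ∈ sat X (S ∩ R).carrier) (hS : e ∈ S.carrier) : e ∈ R.carrier := by
  obtain ⟨s, ⟨h1, h2⟩, h3⟩ := h
  rwa [← S.inj h1 hS h3]

theorem inter_comm' (S R : CopenSection X) : S ∩ R = R ∩ S :=
  CopenSection.ext (Set.inter_comm _ _)

theorem ext_mem {S R : CopenSection X} (h : ∀ e, e ∈ S.carrier ↔ e ∈ R.carrier) : S = R :=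
  CopenSection.ext (Set.ext h)

instance : SkewLattice (CopenSection X) where
  meet_idem x := ext_mem fun e => by
    have := @subset_sat X x.carrier e
    simp only [mem_meet]; tauto
  join_idem x := ext_mem fun e => by
    have := @subset_sat X x.carrier e
    simp only [mem_join]; tauto
  meet_assoc x y z := ext_mem fun e => by
    simp only [mem_meet, sat_meet]; tauto
  join_assoc x y z := ext_mem fun e => by
    simp only [mem_join, sat_join]; tauto
  meet_join_absorb x y := ext_mem fun e => by
    have := @subset_sat X x.carrier e
    simp only [mem_join, mem_meet]; tauto
  join_meet_absorb' x y := ext_mem fun e => by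
    have := @subset_sat X x.carrier e
    simp only [mem_meet, sat_join]; tauto
  join_meet_absorb x y := ext_mem fun e => by
    have := @subset_sat X x.carrier e
    simp only [mem_join, mem_meet]; tauto
  meet_join_absorb' x y := ext_mem fun e => by
    have := @subset_sat X x.carrier e
    simp only [mem_join, mem_meet, sat_meet]; tauto

instance : SkewBooleanAlgebra (CopenSection X) where
  meet_join_distrib x y z := ext_mem fun e => by
    simp only [mem_meet, mem_join, sat_meet]; tauto
  join_meet_distrib x y z := ext_mem fun e => by
    simp only [mem_meet, mem_join, sat_meet, sat_join]; tauto
  zero_join x := ext_mem fun e => by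
    have : e ∉ sat X (0 : CopenSection X).carrier := by rintro ⟨s, h, -⟩; exact h
    simp only [mem_join, mem_zero]; tauto
  join_zero x := ext_mem fun e => by
    simp only [mem_join, mem_zero]; tauto
  sdiff_meet x y := ext_mem fun e => by
    simp only [mem_meet, sat_meet, sat_sdiff, mem_zero]; tauto
  sdiff_join x y := ext_mem fun e => by
    have := @subset_sat X x.carrier e
    simp only [mem_meet, mem_join, sat_meet, sat_sdiff, mem_sdiff]; tauto

theorem inter_natLE (x y : CopenSection X) : NatLE (x ∩ y) x :=
  ⟨ext_mem fun e => by
    have := @subset_sat X (x ∩ y).carrier e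
    have h2 := @mem_of_sat_inter X x y e
    simp only [mem_meet, mem_inter] at *; tauto,
  ext_mem fun e => by
    have := @subset_sat X x.carrier e
    simp only [mem_meet, mem_inter]; tauto⟩

instance : SkewAlgebra (CopenSection X) where
  inter_le_left := inter_natLE
  inter_le_right x y := by rw [inter_comm']; exact inter_natLE y x
  le_inter x y z hx hy := by
    have h1 : ∀ e, e ∈ sat X z.carrier ∧ e ∈ x.carrier ↔ e ∈ z.carrier := fun e => by
      rw [← mem_meet, hx.1]
    have h2 : ∀ e, e ∈ sat X z.carrier ∧ e ∈ y.carrier ↔ e ∈ z.carrier := fun e => by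
      rw [← mem_meet, hy.1]
    refine ⟨ext_mem fun e => ?_, ext_mem fun e => ?_⟩
    · have := h1 e
      have := h2 e
      simp only [mem_meet, mem_inter]; tauto
    · have := h1 e
      have := h2 e
      have := @subset_sat X (x ∩ y).carrier e
      simp only [mem_meet, mem_inter] at *; tauto

instance : RightHanded (CopenSection X) where
  right_handed x y := ext_mem fun e => by
    have := @subset_sat X x.carrier e
    simp only [mem_meet, sat_meet]; tauto

/-- The preimage of a copen section under (the total part of) a morphism. -/
def pullback (a : X ⟶ Y) (S : CopenSection Y) : CopenSection X where
  carrier := (upper a).preimage S.carrier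
  isOpen := (SpaceHom.g_proper a).continuous _ S.isOpen
  isCompact := (SpaceHom.g_proper a).proper _ S.isCompact
  inj := by
    rintro d ⟨d', hd', hd⟩ e ⟨e', he', he⟩ hde
    have h1 : Y.proj d' ∈ lower a (X.proj d) := SpaceHom.comm a _ _ hd
    have h2 : Y.proj e' ∈ lower a (X.proj e) := SpaceHom.comm a _ _ he
    have h3 : d' = e' := S.inj hd' he' (Part.mem_unique (hde ▸ h1) h2)
    subst h3
    exact (SpaceHom.bij a _ _ h2 d' rfl).unique ⟨hde, hd⟩ ⟨rfl, he⟩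

theorem mem_pullback (a : X ⟶ Y) {S : CopenSection Y} {e : X.total} :
    e ∈ (pullback a S).carrier ↔ ∃ e' ∈ S.carrier, e' ∈ upper a e := Iff.rfl

theorem mem_pullback_of (a : X ⟶ Y) {S : CopenSection Y} {e : X.total} {e' : Y.total}
    (he : e' ∈ upper a e) : e ∈ (pullback a S).carrier ↔ e' ∈ S.carrier := by
  constructor
  · rintro ⟨d, h1, h2⟩
    rwa [← Part.mem_unique h2 he]
  · exact fun h => ⟨e', h, he⟩

theorem sat_pullback_of (a : X ⟶ Y) {S : CopenSection Y} {e : X.total} {e' : Y.total}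
    (he : e' ∈ upper a e) :
    e ∈ sat X (pullback a S).carrier ↔ e' ∈ sat Y S.carrier := by
  have h0 : Y.proj e' ∈ lower a (X.proj e) := SpaceHom.comm a _ _ he
  constructor
  · rintro ⟨d, ⟨d', h1, h2⟩, h3⟩
    have h4 : Y.proj d' ∈ lower a (X.proj d) := SpaceHom.comm a _ _ h2
    exact ⟨d', h1, Part.mem_unique (h3 ▸ h4) h0⟩
  · rintro ⟨d', h1, h2⟩
    obtain ⟨d, ⟨h3, h4⟩, -⟩ := SpaceHom.bij a _ _ h0 d' h2
    exact ⟨d, ⟨d', h1, h4⟩, h3⟩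

theorem pullback_ext (a : X ⟶ Y) {S : CopenSection Y} {T : CopenSection X}
    (hT : ∀ e ∈ T.carrier, ∃ e', e' ∈ upper a e)
    (h : ∀ e e', e' ∈ upper a e → (e' ∈ S.carrier ↔ e ∈ T.carrier)) : pullback a S = T :=
  ext_mem fun e => by
    constructor
    · rintro ⟨e', h1, h2⟩
      exact (h e e' h2).1 h1
    · intro he
      obtain ⟨e', h'⟩ := hT e he
      exact ⟨e', (h e e' h').2 he, h'⟩

/-- Taking preimages of copen sections is a homomorphism of skew algebras. -/
def pullbackHom (a : X ⟶ Y) : SkewHom (CopenSection Y) (CopenSection X) where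
  toFun := pullback a
  map_zero := pullback_ext a (fun _ h => h.elim) fun _ _ _ => Iff.rfl
  map_meet S R := pullback_ext a (fun e h => by obtain ⟨e', -, h⟩ := h.2; exact ⟨e', h⟩)
    fun e e' h => by
      simp only [mem_meet, mem_pullback_of a h, sat_pullback_of a h]
  map_join S R := pullback_ext a
    (fun e h => by
      obtain ⟨e', -, h⟩ | ⟨⟨e', -, h⟩, -⟩ := h <;> exact ⟨e', h⟩)
    fun e e' h => by
      simp only [mem_join, mem_pullback_of a h, sat_pullback_of a h]
  map_sdiff S R := pullback_ext a (fun e h => by obtain ⟨e', -, h⟩ := h.1; exact ⟨e', h⟩)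
    fun e e' h => by
      simp only [mem_sdiff, mem_pullback_of a h, sat_pullback_of a h]
  map_inter S R := pullback_ext a (fun e h => by obtain ⟨e', -, h⟩ := h.1; exact ⟨e', h⟩)
    fun e e' h => by
      simp only [mem_inter, mem_pullback_of a h]

end CopenSection

/-- The contravariant functor of the right-handed duality: it sends a skew Boolean space to its
right-handed skew algebra of copen sections, and a morphism `(g, h)` to `S ↦ g⁻¹(S)`. -/
def sectionFunctor : SkewBooleanSpace.{u}ᵒᵖ ⥤ RightSkewAlg.{u} where
  obj X := { carrier := CopenSection X.unop }
  map a := CopenSection.pullbackHom a.unop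
  map_id X := SkewHom.ext <| funext fun S => CopenSection.ext <| by
    change (PFun.id _).preimage S.carrier = S.carrier
    rw [← PFun.coe_id, PFun.coe_preimage]; rfl
  map_comp a b := SkewHom.ext <| funext fun S => CopenSection.ext <| by
    change ((upper a.unop).comp (upper b.unop)).preimage S.carrier = _
    rw [PFun.preimage_comp]; rfl

end SkewDuality

open SkewDuality

/-! The duality is a noncommutative Stone duality: $\mathcal A$ is faithful, full and essentially
surjective.

Faithful: copen sections form a base of $E$ and separate its points. Hence $g(e)$ is the only point
lying in every $S$ with $e\in g^{-1}(S)$ (`mem_upper_iff`), and $h$ is recovered from $g$ because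
fibers are nonempty and $g$ is bijective on them.

Full: given a homomorphism $f$, a point $e$ determines the family of all $S$ with $e\in f(S)$. If
the family is nonempty, compactness gives a point common to its members, and preservation of
$\setminus$ and $\cap$ makes membership at that point equivalent to membership in the family
(`exists_pointRel`). Preservation of $\land$ transports saturations, so the assignment descends to
the bases and is bijective on fibers.

Essentially surjective: right-handedness gives $x\land y\land z=y\land x\land z$ (`meet_left_comm`),
so elements with a common upper bound for $\le$ commute under $\land$. The nonempty prime filters of
$(A,\le)$ are the points of $E$; the shadow of a filter is its base point. An element $a$ is
represented by the set of filters containing it. Such filters separate elements by Zorn's lemma, and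
compactness together with gluing by $\lor$ shows that every copen section is represented.

Cofinality: the $\preceq$-downward closure of the image of a homomorphism is already an ideal
(`isIdeal_natPre`), and $S\preceq R$ means $p(S)\subseteq p(R)$. Cofinality of $\mathcal A(g,h)$
thus says that the sets $p(g^{-1}(R))$ absorb every $p(S)$, which amounts to totality of $h$. Since
both classes contain the isomorphisms, the equivalence restricts. -/

namespace SkewDuality

/-! ## Partial maps -/

/-- The partial function whose graph is a given single-valued relation. -/
noncomputable def relPFun {α β : Type u} (R : α → β → Prop) : α →. β :=
  fun a => ⟨∃ b, R a b, fun h => h.choose⟩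

theorem mem_relPFun {α β : Type u} {R : α → β → Prop}
    (hR : ∀ a b b', R a b → R a b' → b = b') {a : α} {b : β} : b ∈ relPFun R a ↔ R a b := by
  constructor
  · rintro ⟨h, rfl⟩
    exact h.choose_spec
  · intro h
    exact ⟨⟨b, h⟩, hR _ _ _ (Exists.choose_spec (⟨b, h⟩ : ∃ b, R a b)) h⟩

/-- A continuous partial map is proper as soon as the target is covered by open sets with compact
preimages. -/
theorem IsProperPartial.of_cover {X Y : Type u} [TopologicalSpace X] [TopologicalSpace Y]
    [T2Space Y] {f : X →. Y} (hf : PContinuous f)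
    (h : ∀ y, ∃ U, IsOpen U ∧ y ∈ U ∧ IsCompact (f.preimage U)) : IsProperPartial f where
  continuous := hf
  proper K hK := by
    -- Finitely many of the given compact preimages cover the preimage of `K`. Keeping `C` inside
    -- the domain lets the preimage of `K` be cut out of `C` by removing the open preimage of the
    -- complement.
    obtain ⟨C, hC, hKC, hCd⟩ : ∃ C, IsCompact C ∧ f.preimage K ⊆ C ∧ C ⊆ f.Dom := by
      refine hK.induction_on (p := fun K => ∃ C, IsCompact C ∧ f.preimage K ⊆ C ∧ C ⊆ f.Dom)
        ⟨∅, isCompact_empty, ?_, Set.empty_subset _⟩ ?_ ?_ ?_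
      · rintro x ⟨y, hy, -⟩
        exact hy.elim
      · rintro s t hst ⟨C, h1, h2, h3⟩
        exact ⟨C, h1, (f.preimage_mono hst).trans h2, h3⟩
      · rintro s t ⟨C, h1, h2, h3⟩ ⟨C', h1', h2', h3'⟩
        refine ⟨C ∪ C', h1.union h1', ?_, Set.union_subset h3 h3'⟩
        rw [PFun.preimage_union]
        exact Set.union_subset_union h2 h2'
      · intro y _
        obtain ⟨U, h1, h2, h3⟩ := h y
        exact ⟨U, mem_nhdsWithin_of_mem_nhds (h1.mem_nhds h2), f.preimage U, h3, subset_rfl,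
          f.preimage_subset_dom U⟩
    have : f.preimage K = C \ f.preimage Kᶜ := by
      ext x
      constructor
      · intro hx
        refine ⟨hKC hx, ?_⟩
        obtain ⟨y, hy, hxy⟩ := hx
        rintro ⟨y', hy', hxy'⟩
        exact hy' (Part.mem_unique hxy hxy' ▸ hy)
      · rintro ⟨hx, hx'⟩
        obtain ⟨y, hy⟩ := (PFun.mem_dom f x).1 (hCd hx)
        by_contra hxK
        exact hx' ⟨y, fun hyK => hxK ⟨y, hyK, hy⟩, hy⟩
    rw [this]
    exact hC.diff (hf _ hK.isClosed.isOpen_compl)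

/-! ## Copen sections -/

namespace CopenSection

variable {X Y : SkewBooleanSpace.{u}}

theorem exists_mem_subset {e : X.total} {U : Set X.total} (hU : IsOpen U) (he : e ∈ U) :
    ∃ S : CopenSection X, e ∈ S.carrier ∧ S.carrier ⊆ U := by
  obtain ⟨φ, hφ, hφ'⟩ := X.etale e
  obtain ⟨K, hK, hKU, hKc⟩ := LocallyCompactSpace.local_compact_nhds e (U ∩ φ.source)
    ((hU.inter φ.open_source).mem_nhds ⟨he, hφ⟩)
  obtain ⟨C, hC, heC, hCK⟩ :=
    (BooleanSpace.zeroDimensional (X := X.total)).mem_nhds_iff.1 hK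
  refine ⟨⟨C, hC.2, hKc.of_isClosed_subset hC.1 hCK, ?_⟩, heC, fun x hx => (hKU (hCK hx)).1⟩
  rw [hφ']
  exact φ.injOn.mono fun x hx => (hKU (hCK hx)).2

theorem exists_mem (e : X.total) : ∃ S : CopenSection X, e ∈ S.carrier :=
  let ⟨S, h, _⟩ := exists_mem_subset isOpen_univ (Set.mem_univ e)
  ⟨S, h⟩

theorem eq_of_mem_iff {e e' : X.total}
    (h : ∀ S : CopenSection X, e ∈ S.carrier → e' ∈ S.carrier) : e = e' := by
  by_contra hne
  obtain ⟨U, V, hU, -, h1, h2, h3⟩ := t2_separation hne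
  obtain ⟨S, hS, hSU⟩ := exists_mem_subset hU h1
  exact Set.disjoint_left.1 h3 (hSU (h S hS)) h2

/-- The images of copen sections are cofinal among the compact subsets of the base. -/
theorem exists_subset_image {K : Set X.base} (hK : IsCompact K) :
    ∃ S : CopenSection X, K ⊆ X.proj '' S.carrier := by
  refine hK.induction_on (p := fun K => ∃ S : CopenSection X, K ⊆ X.proj '' S.carrier)
    ⟨0, Set.empty_subset _⟩ ?_ ?_ ?_
  · rintro s t hst ⟨S, hS⟩
    exact ⟨S, hst.trans hS⟩
  · rintro s t ⟨S, hS⟩ ⟨R, hR⟩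
    refine ⟨S ⊔ R, ?_⟩
    rintro x hx
    obtain ⟨e, rfl⟩ := X.surj x
    refine (sat_join (S := S) (R := R)).2 ?_
    exact hx.imp (fun h => hS h) (fun h => hR h)
  · intro x _
    obtain ⟨e, rfl⟩ := X.surj x
    obtain ⟨S, hS⟩ := exists_mem e
    exact ⟨_, mem_nhdsWithin_of_mem_nhds ((X.etale.isOpenMap _ S.isOpen).mem_nhds ⟨e, hS, rfl⟩),
      S, subset_rfl⟩

theorem natPre_iff {S R : CopenSection X} :
    NatPre S R ↔ X.proj '' S.carrier ⊆ X.proj '' R.carrier := by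
  constructor
  · rintro h _ ⟨e, he, rfl⟩
    rw [← (h : S ⊓ R ⊓ S = S)] at he
    exact (sat_meet.1 he.1).2
  · intro h
    exact ext_mem fun e => ⟨fun h => h.2,
      fun he => ⟨sat_meet.2 ⟨subset_sat he, h ⟨e, he, rfl⟩⟩, he⟩⟩

/-- The operation `\` removes whole fibers; taking `S ∩ R` first yields the set-theoretic
difference, expressed in operations that homomorphisms preserve. -/
theorem mem_sdiff_inter {S R : CopenSection X} {e : X.total} :
    e ∈ (S \ (S ∩ R)).carrier ↔ e ∈ S.carrier ∧ e ∉ R.carrier := by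
  rw [mem_sdiff]
  refine and_congr_right fun he => not_congr ⟨fun h => mem_of_sat_inter h he,
    fun h => subset_sat ⟨he, h⟩⟩

end CopenSection

/-! ## Faithfulness -/

open CopenSection

theorem mem_upper_iff {X Y : SkewBooleanSpace.{u}} (a : X ⟶ Y) {e : X.total} {e' : Y.total} :
    e' ∈ upper a e ↔ (∃ S, e ∈ (pullback a S).carrier) ∧
      ∀ S, e ∈ (pullback a S).carrier → e' ∈ S.carrier := by
  constructor
  · intro h
    obtain ⟨S, hS⟩ := exists_mem e'
    exact ⟨⟨S, (mem_pullback_of a h).2 hS⟩, fun S hS => (mem_pullback_of a h).1 hS⟩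
  · rintro ⟨⟨S, d, hd, hde⟩, h⟩
    have : d = e' := eq_of_mem_iff fun T hT => h T ⟨d, hT, hde⟩
    exact this ▸ hde

theorem mem_lower_iff {X Y : SkewBooleanSpace.{u}} (a : X ⟶ Y) {x : X.base} {x' : Y.base} :
    x' ∈ lower a x ↔ ∃ e e', X.proj e = x ∧ Y.proj e' = x' ∧ e' ∈ upper a e := by
  constructor
  · intro h
    obtain ⟨e', he'⟩ := Y.surj x'
    obtain ⟨e, ⟨h1, h2⟩, -⟩ := SpaceHom.bij a _ _ h e' he'
    exact ⟨e, e', h1, he', h2⟩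
  · rintro ⟨e, e', rfl, rfl, h⟩
    exact SpaceHom.comm a _ _ h

theorem eq_of_pullback_eq {X Y : SkewBooleanSpace.{u}} {a b : X ⟶ Y}
    (h : ∀ S, pullback a S = pullback b S) : a = b := by
  have hu : upper a = upper b := by
    funext e
    refine Part.ext fun e' => ?_
    rw [mem_upper_iff, mem_upper_iff]
    simp only [h]
  refine SpaceHom.ext hu ?_
  funext x
  refine Part.ext fun x' => ?_
  change x' ∈ lower a x ↔ x' ∈ lower b x
  rw [mem_lower_iff, mem_lower_iff, hu]

instance : sectionFunctor.{u}.Faithful where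
  map_injective {X Y} a b h := by
    refine Quiver.Hom.unop_inj (eq_of_pullback_eq fun S => ?_)
    exact congrFun (congrArg SkewHom.toFun h) S

/-! ## Fullness -/

section Full

variable {X Y : SkewBooleanSpace.{u}} (f : SkewHom (CopenSection Y) (CopenSection X))

/-- The relation between points induced by a homomorphism of algebras of copen sections. -/
def PointRel (e : X.total) (e' : Y.total) : Prop :=
  (∃ S, e ∈ (f.toFun S).carrier) ∧ ∀ S, e ∈ (f.toFun S).carrier ↔ e' ∈ S.carrier

variable {f}

theorem PointRel.unique {e : X.total} {e' d' : Y.total} (h : PointRel f e e')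
    (h' : PointRel f e d') : e' = d' :=
  eq_of_mem_iff fun S hS => (h'.2 S).1 ((h.2 S).2 hS)

/-- The sections whose image contains `e` are compact, nonempty and closed under `∩`, so they share
a point `e'`. If `e'` lay in some `R` outside this family, the difference of `S` and `R` would
belong to the family and exclude `e'`. -/
theorem exists_pointRel {e : X.total} {S : CopenSection Y} (he : e ∈ (f.toFun S).carrier) :
    ∃ e', PointRel f e e' := by
  let I := {R : CopenSection Y // e ∈ (f.toFun R).carrier}
  have hne : (⋂ R : I, R.1.carrier).Nonempty := by
    have : Nonempty I := ⟨⟨S, he⟩⟩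
    refine IsCompact.nonempty_iInter_of_directed_nonempty_isCompact_isClosed
      (fun R : I => R.1.carrier) ?_ ?_ (fun R => R.1.isCompact) (fun R => R.1.isCompact.isClosed)
    · intro R T
      refine ⟨⟨R.1 ∩ T.1, ?_⟩, fun x hx => hx.1, fun x hx => hx.2⟩
      rw [f.map_inter]
      exact ⟨R.2, T.2⟩
    · rintro ⟨R, hR⟩
      by_contra hemp
      have : R = 0 := ext_mem fun x => ⟨fun hx => hemp ⟨x, hx⟩, fun hx => hx.elim⟩
      rw [this, f.map_zero] at hR
      exact hR
  obtain ⟨e', he'⟩ := hne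
  rw [Set.mem_iInter] at he'
  refine ⟨e', ⟨S, he⟩, fun R => ⟨fun hR => he' ⟨R, hR⟩, fun hR => ?_⟩⟩
  by_contra hR'
  have : e ∈ (f.toFun (S \ (S ∩ R))).carrier := by
    rw [f.map_sdiff, f.map_inter]
    exact mem_sdiff_inter.2 ⟨he, hR'⟩
  exact (mem_sdiff_inter.1 (he' ⟨_, this⟩)).2 hR

/-- Once a section `R` contains the point, lying in the saturation of `S` is the same as lying in `S
⊓ R`, which `f` preserves. -/
theorem PointRel.mem_sat_iff {e : X.total} {e' : Y.total} (h : PointRel f e e')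
    (S : CopenSection Y) : e ∈ sat X (f.toFun S).carrier ↔ e' ∈ sat Y S.carrier := by
  obtain ⟨R, hR⟩ := h.1
  have h1 := h.2 (S ⊓ R)
  rw [f.map_meet, mem_meet, mem_meet] at h1
  have := (h.2 R).1 hR
  tauto

theorem PointRel.proj_eq {d e : X.total} {d' e' : Y.total} (h : PointRel f d d')
    (h' : PointRel f e e') (hde : X.proj d = X.proj e) : Y.proj d' = Y.proj e' := by
  by_contra hne
  obtain ⟨U, V, hU, hV, h1, h2, h3⟩ := t2_separation hne
  obtain ⟨S, hS, hSU⟩ := exists_mem_subset (hU.preimage Y.etale.continuous) h1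
  have : e' ∈ sat Y S.carrier := by
    rw [← h'.mem_sat_iff, ← sat_congr hde, h.mem_sat_iff]
    exact subset_sat hS
  obtain ⟨s, hs, hs'⟩ := this
  exact Set.disjoint_left.1 h3 (hSU hs) (hs' ▸ h2)

variable (f)

/-- The partial map of total spaces induced by a homomorphism. -/
noncomputable def inducedUpper : X.total →. Y.total := relPFun (PointRel f)

/-- The partial map of bases induced by a homomorphism. -/
noncomputable def inducedLower : X.base →. Y.base :=
  relPFun fun x x' => ∃ e e', X.proj e = x ∧ Y.proj e' = x' ∧ PointRel f e e'

variable {f}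

theorem mem_inducedUpper {e : X.total} {e' : Y.total} :
    e' ∈ inducedUpper f e ↔ PointRel f e e' :=
  mem_relPFun fun _ _ _ h h' => h.unique h'

theorem mem_inducedLower {x : X.base} {x' : Y.base} :
    x' ∈ inducedLower f x ↔ ∃ e e', X.proj e = x ∧ Y.proj e' = x' ∧ PointRel f e e' :=
  mem_relPFun <| by
    rintro x _ _ ⟨d, d', hd, rfl, h⟩ ⟨e, e', he, rfl, h'⟩
    exact h.proj_eq h' (hd.trans he.symm)

theorem inducedUpper_preimage (S : CopenSection Y) :
    (inducedUpper f).preimage S.carrier = (f.toFun S).carrier := by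
  ext e
  constructor
  · rintro ⟨e', he', h⟩
    exact ((mem_inducedUpper.1 h).2 S).2 he'
  · intro he
    obtain ⟨e', h⟩ := exists_pointRel he
    exact ⟨e', (h.2 S).1 he, mem_inducedUpper.2 h⟩

theorem inducedLower_preimage (V : Set Y.base) :
    (inducedLower f).preimage V = X.proj '' (inducedUpper f).preimage (Y.proj ⁻¹' V) := by
  ext x
  constructor
  · rintro ⟨x', hx', hxx'⟩
    obtain ⟨e, e', rfl, rfl, h⟩ := mem_inducedLower.1 hxx'
    exact ⟨e, ⟨e', hx', mem_inducedUpper.2 h⟩, rfl⟩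
  · rintro ⟨e, ⟨e', he', h⟩, rfl⟩
    exact ⟨_, he', mem_inducedLower.2 ⟨e, e', rfl, rfl, mem_inducedUpper.1 h⟩⟩

theorem inducedLower_preimage_image (S : CopenSection Y) :
    (inducedLower f).preimage (Y.proj '' S.carrier) = X.proj '' (f.toFun S).carrier := by
  rw [inducedLower_preimage]
  refine Set.Subset.antisymm ?_ (Set.image_mono ?_)
  · rintro _ ⟨e, ⟨e', he', h⟩, rfl⟩
    exact ((mem_inducedUpper.1 h).mem_sat_iff S).2 he'
  · rw [← inducedUpper_preimage]
    exact PFun.preimage_mono _ (Set.subset_preimage_image _ _)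

theorem inducedUpper_continuous : PContinuous (inducedUpper f) := by
  intro U hU
  rw [isOpen_iff_forall_mem_open]
  rintro e ⟨e', he', h⟩
  obtain ⟨S, hS, hSU⟩ := exists_mem_subset hU he'
  refine ⟨(f.toFun S).carrier, ?_, (f.toFun S).isOpen, ((mem_inducedUpper.1 h).2 S).2 hS⟩
  rw [← inducedUpper_preimage]
  exact PFun.preimage_mono _ hSU

theorem inducedLower_continuous : PContinuous (inducedLower f) := by
  intro V hV
  rw [inducedLower_preimage]
  exact X.etale.isOpenMap _ (inducedUpper_continuous _ (hV.preimage Y.etale.continuous))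

theorem inducedUpper_proper : IsProperPartial (inducedUpper f) :=
  .of_cover inducedUpper_continuous fun y =>
    let ⟨S, hS⟩ := exists_mem y
    ⟨S.carrier, S.isOpen, hS, (inducedUpper_preimage (f := f) S) ▸ (f.toFun S).isCompact⟩

theorem inducedLower_proper : IsProperPartial (inducedLower f) := by
  refine .of_cover inducedLower_continuous fun y => ?_
  obtain ⟨e, rfl⟩ := Y.surj y
  obtain ⟨S, hS⟩ := exists_mem e
  refine ⟨_, Y.etale.isOpenMap _ S.isOpen, ⟨e, hS, rfl⟩, ?_⟩
  rw [inducedLower_preimage_image]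
  exact (f.toFun S).isCompact.image X.etale.continuous

variable (f)

/-- The morphism of skew Boolean spaces induced by a homomorphism. -/
noncomputable def inducedHom : X ⟶ Y where
  g := inducedUpper f
  h := inducedLower f
  g_proper := inducedUpper_proper
  h_proper := inducedLower_proper
  comm e e' h := mem_inducedLower.2 ⟨e, e', rfl, rfl, mem_inducedUpper.1 h⟩
  bij := by
    rintro x x' h d' rfl
    obtain ⟨e, e', rfl, hd, h⟩ := mem_inducedLower.1 h
    obtain ⟨R, hR⟩ := exists_mem d'
    -- The saturation of the image of `R` meets the fiber of `e`, which supplies the preimage of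
    -- `d'`; injectivity of the projection on that image makes it unique.
    obtain ⟨d, hdR, hde⟩ := (h.mem_sat_iff R).2 ⟨d', hR, hd.symm⟩
    obtain ⟨c', hc⟩ := exists_pointRel hdR
    have : c' = d' := R.inj ((hc.2 R).1 hdR) hR ((hc.proj_eq h hde).trans hd)
    subst this
    refine ⟨d, ⟨hde, mem_inducedUpper.2 hc⟩, fun b ⟨hb, hb'⟩ => ?_⟩
    exact (f.toFun R).inj (((mem_inducedUpper.1 hb').2 R).2 hR) hdR (hb.trans hde.symm)

end Full

instance : sectionFunctor.{u}.Full where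
  map_surjective {X Y} f := ⟨(inducedHom (X := Y.unop) (Y := X.unop) f).op,
    SkewHom.ext <| funext fun S => CopenSection.ext <| inducedUpper_preimage S⟩

/-! ## Cofinality -/

/-- If `h` is total, it maps the compact set `p(S)` to a compact set, which some `p'(R)` covers;
fiber bijectivity lifts back to `g⁻¹(R)`. Conversely, each base point lies in some `p(S)`, hence in
some `p(g⁻¹(R))`, which is contained in the domain of `h`. -/
theorem semitotal_iff {X Y : SkewBooleanSpace.{u}} (a : X ⟶ Y) :
    semitotal a ↔ ∀ S : CopenSection X, ∃ R : CopenSection Y, NatPre S (pullback a R) := by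
  constructor
  · intro h S
    have hK : IsCompact (X.proj '' S.carrier) := S.isCompact.image X.etale.continuous
    have hdom : ∀ x, ∃ x', x' ∈ lower a x := fun x =>
      (PFun.mem_dom _ x).1 ((show (lower a).Dom = Set.univ from h) ▸ Set.mem_univ x)
    choose φ hφ using hdom
    have hpre : ∀ V, (lower a).preimage V = φ ⁻¹' V := fun V => by
      ext x
      exact ⟨fun ⟨y, hy, hy'⟩ => (Part.mem_unique hy' (hφ x) ▸ hy : φ x ∈ V),
        fun hx => ⟨_, hx, hφ x⟩⟩
    have hcont : Continuous φ := ⟨fun V hV => hpre V ▸ (SpaceHom.h_proper a).continuous V hV⟩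
    obtain ⟨R, hR⟩ := exists_subset_image (hK.image hcont)
    refine ⟨R, natPre_iff.2 ?_⟩
    rintro _ ⟨e, he, rfl⟩
    obtain ⟨r, hr, hr'⟩ := hR ⟨_, ⟨e, he, rfl⟩, rfl⟩
    obtain ⟨d, ⟨hd, hd'⟩, -⟩ := SpaceHom.bij a _ _ (hφ (X.proj e)) r hr'
    exact ⟨d, ⟨r, hr, hd'⟩, hd⟩
  · refine fun h => Set.eq_univ_of_forall fun x => ?_
    obtain ⟨e, rfl⟩ := X.surj x
    obtain ⟨S, hS⟩ := exists_mem e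
    obtain ⟨R, hR⟩ := h S
    obtain ⟨d, ⟨d', -, hd⟩, hde⟩ := natPre_iff.1 hR ⟨e, hS, rfl⟩
    rw [← hde]
    exact (PFun.mem_dom _ _).2 ⟨_, SpaceHom.comm a _ _ hd⟩

/-! ## Algebra in right-handed skew algebras -/

section Algebra

open SkewLattice SkewBooleanAlgebra SkewAlgebra

variable {A : Type u} [SkewAlgebra A] {a b c d x y z : A}

theorem zero_meet (x : A) : 0 ⊓ x = 0 := by
  have := meet_join_absorb (0 : A) x
  rwa [zero_join] at this

theorem meet_zero (x : A) : x ⊓ 0 = 0 := by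
  have := join_meet_absorb' (0 : A) x
  rwa [join_zero] at this

theorem meet_eq_zero_comm (h : x ⊓ y = 0) : y ⊓ x = 0 := by
  rw [← meet_idem (y ⊓ x), meet_assoc, ← meet_assoc x, h, zero_meet, meet_zero]

theorem natLE_refl (x : A) : NatLE x x := ⟨meet_idem x, meet_idem x⟩

theorem NatLE.trans (h : NatLE x y) (h' : NatLE y z) : NatLE x z :=
  ⟨by rw [← h.1, meet_assoc, h'.1], by rw [← h.2, ← meet_assoc, h'.2]⟩

theorem NatLE.antisymm (h : NatLE x y) (h' : NatLE y x) : x = y := h.1.symm.trans h'.2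

theorem natLE_zero_iff : NatLE x 0 ↔ x = 0 :=
  ⟨fun h => h.1.symm.trans (meet_zero x), fun h => h ▸ natLE_refl _⟩

theorem zero_natLE (x : A) : NatLE 0 x := ⟨zero_meet x, meet_zero x⟩

theorem meet_eq_of_join_eq (hz : NatLE z x) (h : c ⊔ d = x) (hd : z ⊓ d = 0) : z ⊓ c = z := by
  have := meet_join_distrib z c d
  rw [h, hz.1, hd, join_zero] at this
  exact this.symm

theorem natLE_of_join_eq (h : c ⊔ d = x) (hd : c ⊓ d = 0) : NatLE c x := by
  subst h
  refine ⟨meet_join_absorb c d, ?_⟩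
  rw [join_meet_distrib, meet_idem, meet_eq_zero_comm hd, join_zero]

theorem inter_eq_of_natLE (h : NatLE x y) : x ∩ y = x :=
  (inter_le_left x y).antisymm (le_inter _ _ _ (natLE_refl x) h)

theorem inter_comm (x y : A) : x ∩ y = y ∩ x :=
  (le_inter _ _ _ (inter_le_right x y) (inter_le_left x y)).antisymm
    (le_inter _ _ _ (inter_le_right y x) (inter_le_left y x))

theorem eq_zero_of_natLE (hy : NatLE x y) (hz : NatLE x z) (h : y ⊓ z = 0) : x = 0 := by
  rw [← hy.2, ← hz.2, ← meet_assoc, h, zero_meet]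

theorem inter_eq_of_natLE' (h : NatLE x y) : y ∩ x = x := by
  rw [inter_comm, inter_eq_of_natLE h]

theorem inter_eq_zero (h : x ⊓ y = 0) : x ∩ y = 0 :=
  eq_zero_of_natLE (inter_le_left x y) (inter_le_right x y) h

variable [RightHanded A]

theorem meet_meet_self (x y : A) : x ⊓ y ⊓ x = y ⊓ x := RightHanded.right_handed x y

theorem meet_natLE_right (x y : A) : NatLE (x ⊓ y) y :=
  ⟨by rw [meet_assoc, meet_idem], by rw [← meet_assoc, meet_meet_self]⟩

theorem sdiff_meet_right (x y : A) : (x \ y) ⊓ (y ⊓ x) = 0 := by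
  rw [← meet_meet_self x y]; exact sdiff_meet x y

theorem sdiff_join_right (x y : A) : (x \ y) ⊔ (y ⊓ x) = x := by
  rw [← meet_meet_self x y]; exact sdiff_join x y

theorem sdiff_natLE (x y : A) : NatLE (x \ y) x :=
  natLE_of_join_eq (sdiff_join_right x y) (sdiff_meet_right x y)

theorem sdiff_meet_self (x y : A) : (x \ y) ⊓ y = 0 := by
  have h : x ⊓ y = y ⊓ x ⊓ y := (meet_meet_self y x).symm
  rw [← (sdiff_natLE x y).1, meet_assoc, h, ← meet_assoc, sdiff_meet_right, zero_meet]

theorem meet_sdiff_self (x y : A) : y ⊓ (x \ y) = 0 := meet_eq_zero_comm (sdiff_meet_self x y)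

theorem sdiff_join_of_natLE (h : NatLE y x) : (x \ y) ⊔ y = x := by
  have := sdiff_join_right x y
  rwa [h.1] at this

/-- Two elements in a common principal order ideal which are equivalent for `⪯` are equal. -/
theorem eq_of_natLE_of_equiv (hx : NatLE x a) (hy : NatLE y a) (h1 : x ⊓ y = y) (h2 : y ⊓ x = x) :
    x = y := by
  have h3 : y ⊓ (a \ x) = 0 := by
    refine meet_eq_zero_comm ?_
    rw [← h1, ← meet_assoc, sdiff_meet_self, zero_meet]
  have h4 : y ⊓ ((a \ x) ⊔ x) = x := by rw [meet_join_distrib, h3, zero_join, h2]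
  rw [← h4, sdiff_join_of_natLE hx, hy.1]

/-- Both sides lie below `z`, and right-handedness collapses their product in either order to the
second factor, so `eq_of_natLE_of_equiv` applies. -/
theorem meet_left_comm (x y z : A) : x ⊓ (y ⊓ z) = y ⊓ (x ⊓ z) := by
  have key : ∀ x y : A, (x ⊓ (y ⊓ z)) ⊓ (y ⊓ (x ⊓ z)) = y ⊓ (x ⊓ z) := fun x y => by
    have h1 : x ⊓ (y ⊓ z) ⊓ (y ⊓ (x ⊓ z)) = x ⊓ (y ⊓ (z ⊓ y) ⊓ (x ⊓ z)) := by
      simp only [meet_assoc]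
    have h2 : y ⊓ (z ⊓ y) = z ⊓ y := by rw [← meet_assoc, meet_meet_self]
    have h3 : x ⊓ (z ⊓ y ⊓ (x ⊓ z)) = x ⊓ (z ⊓ y) ⊓ x ⊓ z := by simp only [meet_assoc]
    have h4 : z ⊓ y ⊓ x ⊓ z = z ⊓ (y ⊓ x) ⊓ z := by simp only [meet_assoc]
    rw [h1, h2, h3, meet_meet_self, h4, meet_meet_self, meet_assoc]
  refine eq_of_natLE_of_equiv (a := z) ?_ ?_ (key x y) (key y x)
  · rw [← meet_assoc]; exact meet_natLE_right _ _
  · rw [← meet_assoc]; exact meet_natLE_right _ _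

theorem meet_comm_of_natLE (hx : NatLE x a) (hy : NatLE y a) : x ⊓ y = y ⊓ x := by
  rw [← hy.1, meet_left_comm, hy.1, hx.1]

/-- Both are complements of `y ⊓ x` among the elements below `x`, where meets commute; complements
there are unique. -/
theorem sdiff_meet_eq (x y : A) : x \ (y ⊓ x) = x \ y := by
  have h1 : NatLE (x \ (y ⊓ x)) x := sdiff_natLE _ _
  have h2 : NatLE (x \ y) x := sdiff_natLE _ _
  have e1 : (x \ (y ⊓ x)) ⊔ (y ⊓ x) = x := sdiff_join_of_natLE (meet_natLE_right y x)
  have e2 : (x \ y) ⊔ (y ⊓ x) = x := sdiff_join_right x y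
  have f1 : (x \ (y ⊓ x)) ⊓ (x \ y) = x \ (y ⊓ x) :=
    meet_eq_of_join_eq h1 e2 (sdiff_meet_self _ _)
  have f2 : (x \ y) ⊓ (x \ (y ⊓ x)) = x \ y :=
    meet_eq_of_join_eq h2 e1 (sdiff_meet_right _ _)
  rw [← f1, meet_comm_of_natLE h1 h2, f2]

theorem sdiff_meet_inter_eq (a b : A) : b \ (b ∩ (a ⊓ b)) = b \ a := by
  rw [inter_eq_of_natLE' (meet_natLE_right a b), sdiff_meet_eq]

theorem natLE_sdiff_inter (hc : NatLE c a) (h : c ∩ b = 0) : NatLE c (a \ (a ∩ b)) := by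
  have hu : NatLE (a ∩ b) a := inter_le_left a b
  have hcu : c ⊓ (a ∩ b) = 0 := by
    have h1 : NatLE (c ⊓ (a ∩ b)) (a ∩ b) := meet_natLE_right _ _
    have h2 : NatLE (c ⊓ (a ∩ b)) c := by
      rw [meet_comm_of_natLE hc hu]; exact meet_natLE_right _ _
    rw [← natLE_zero_iff, ← h]
    exact le_inter _ _ _ h2 (h1.trans (inter_le_right a b))
  have e : (a \ (a ∩ b)) ⊔ (a ∩ b) = a := sdiff_join_of_natLE hu
  constructor
  · conv_rhs => rw [← hc.1, ← e, meet_join_distrib, hcu, join_zero]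
  · conv_rhs => rw [← hc.2, ← e, join_meet_distrib, meet_eq_zero_comm hcu, join_zero]

theorem natLE_join_left (a b : A) : NatLE a (a ⊔ b) := by
  refine ⟨meet_join_absorb a b, ?_⟩
  rw [join_meet_distrib, meet_idem, ← meet_meet_self a b, meet_assoc, join_meet_absorb]

theorem sdiff_natLE_join (a b : A) : NatLE (b \ a) (a ⊔ b) :=
  ⟨by rw [meet_join_distrib, sdiff_meet_self, zero_join, (sdiff_natLE b a).1],
    by rw [join_meet_distrib, meet_sdiff_self, zero_join, (sdiff_natLE b a).2]⟩

theorem join_sdiff_natLE (a b : A) : NatLE ((a ⊔ b) \ a) b := by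
  have h := sdiff_natLE (a ⊔ b) a
  constructor
  · conv_rhs => rw [← h.1, meet_join_distrib, sdiff_meet_self, zero_join]
  · conv_rhs => rw [← h.2, join_meet_distrib, meet_sdiff_self, zero_join]

theorem natPre_trans {x y z : A} (h : NatPre x y) (h' : NatPre y z) : NatPre x z := by
  have e1 : y ⊓ x = x := (meet_meet_self x y).symm.trans h
  have e2 : z ⊓ y = y := (meet_meet_self y z).symm.trans h'
  refine (meet_meet_self x z).trans ?_
  rw [← e1, ← meet_assoc, e2]

theorem meet_eq_inter (hx : NatLE x a) (hy : NatLE y a) : x ⊓ y = x ∩ y := by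
  have h1 : NatLE (x ⊓ y) x := by
    rw [meet_comm_of_natLE hx hy]; exact meet_natLE_right _ _
  refine (le_inter _ _ _ h1 (meet_natLE_right x y)).antisymm ⟨?_, ?_⟩
  · rw [← meet_assoc, (inter_le_left x y).1, (inter_le_right x y).1]
  · rw [meet_assoc, (inter_le_right x y).2, (inter_le_left x y).2]

end Algebra

/-! ## The spectrum -/

open SkewLattice SkewBooleanAlgebra SkewAlgebra

theorem isClopen_eval {A : Type u} (a : A) : IsClopen {F : A → Bool | F a = true} :=
  (isClopen_discrete {b : Bool | b = true}).preimage (continuous_apply a)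

/-- A space carrying the topology induced by an injective map to a Cantor cube, and covered by
compact cylinders, is Boolean. -/
theorem BooleanSpace.of_isEmbedding {X A : Type u} [TopologicalSpace X] {φ : X → A → Bool}
    (hφ : Topology.IsEmbedding φ) (hc : ∀ a, IsCompact {x | φ x a = true})
    (hne : ∀ x, ∃ a, φ x a = true) : BooleanSpace X := by
  have ht2 : T2Space X := hφ.t2Space
  have : WeaklyLocallyCompactSpace X := ⟨fun x => by
    obtain ⟨a, ha⟩ := hne x
    refine ⟨_, hc a, IsOpen.mem_nhds ?_ ha⟩
    exact (isClopen_eval a).isOpen.preimage hφ.continuous⟩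
  refine ⟨inferInstance, ht2, ?_⟩
  refine TopologicalSpace.isTopologicalBasis_of_isOpen_of_nhds (fun s hs => hs.2) ?_
  intro x U hx hU
  obtain ⟨V, hV, rfl⟩ := hφ.isOpen_iff.1 hU
  obtain ⟨W, hW, hxW, hWV⟩ :=
    (isTopologicalBasis_isClopen (X := A → Bool)).exists_subset_of_mem_open hx hV
  exact ⟨φ ⁻¹' W, hW.preimage hφ.continuous, hxW, fun y hy => hWV hy⟩

section Spectrum

variable (A : Type u) [SkewAlgebra A]

/-- Prime filters, possibly empty, of the poset `(A, ≤)`. -/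
structure IsPrimeFilter {A : Type u} [SkewAlgebra A] (F : A → Bool) : Prop where
  zero : ¬ F 0
  inter : ∀ a b, F (a ∩ b) ↔ F a ∧ F b
  prime : ∀ a b, F a → F b ∨ F (a \ (a ∩ b))

/-- Each axiom constrains finitely many coordinates of the Cantor cube. Admitting the empty filter
is what keeps the set closed; nonemptiness is restored on the cylinders, which are therefore
compact. -/
theorem isClosed_isPrimeFilter : IsClosed {F : A → Bool | IsPrimeFilter F} := by
  have : {F : A → Bool | IsPrimeFilter F} = {F | ¬ F 0} ∩
      ((⋂ a, ⋂ b, {F | F (a ∩ b) ↔ F a ∧ F b}) ∩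
        ⋂ a, ⋂ b, {F | F a → F b ∨ F (a \ (a ∩ b))}) := by
    ext F
    simp only [Set.mem_inter_iff, Set.mem_iInter, Set.mem_ofPred_eq]
    exact ⟨fun h => ⟨h.zero, h.inter, h.prime⟩, fun h => ⟨h.1, h.2.1, h.2.2⟩⟩
  rw [this]
  refine IsClosed.inter ?_ (IsClosed.inter (isClosed_iInter fun a => isClosed_iInter fun b => ?_)
    (isClosed_iInter fun a => isClosed_iInter fun b => ?_))
  · exact (isClopen_eval (0 : A)).compl.isClosed
  · exact (isClosed_discrete {t : Bool × Bool × Bool | t.1 ↔ t.2.1 ∧ t.2.2}).preimage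
      (f := fun F : A → Bool => (F (a ∩ b), F a, F b)) (by fun_prop)
  · exact (isClosed_discrete {t : Bool × Bool × Bool | t.1 → t.2.1 ∨ t.2.2}).preimage
      (f := fun F : A → Bool => (F a, F b, F (a \ (a ∩ b)))) (by fun_prop)

/-- The points of the total space of the spectrum: nonempty prime filters. -/
abbrev Pt : Type u := {F : A → Bool // IsPrimeFilter F ∧ ∃ a, F a}

variable {A}

/-- The points whose prime filter contains a given element. -/
def cyl (a : A) : Set (Pt A) := {F | F.1 a = true}

theorem isOpen_cyl (a : A) : IsOpen (cyl a) :=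
  (isClopen_eval a).isOpen.preimage continuous_subtype_val

theorem isCompact_cyl (a : A) : IsCompact (cyl a) := by
  refine Topology.IsEmbedding.subtypeVal.isCompact_iff.2 ?_
  have : Subtype.val '' cyl a = {F : A → Bool | IsPrimeFilter F} ∩ {F | F a = true} := by
    ext F
    constructor
    · rintro ⟨F, h, rfl⟩
      exact ⟨F.2.1, h⟩
    · rintro ⟨h, h'⟩
      exact ⟨⟨F, h, a, h'⟩, h', rfl⟩
  rw [this]
  exact ((isClosed_isPrimeFilter A).inter (isClopen_eval a).isClosed).isCompact

instance : BooleanSpace (Pt A) :=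
  .of_isEmbedding (φ := Subtype.val) Topology.IsEmbedding.subtypeVal isCompact_cyl
    fun F => F.2.2

/-- The prime ideal complement under a prime filter: the elements defined at the base point. -/
noncomputable def shadow (F : Pt A) (a : A) : Bool :=
  @decide (∃ b, F.1 b ∧ F.1 (a ⊓ b)) (Classical.propDecidable _)

variable (A) in
/-- The base of the spectrum. -/
abbrev BasePt : Type u := Set.range (shadow : Pt A → A → Bool)

/-- The projection of the spectrum. -/
noncomputable def specProj : Pt A → BasePt A := Set.rangeFactorization shadow

theorem specProj_surjective : Function.Surjective (specProj : Pt A → BasePt A) :=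
  Set.rangeFactorization_surjective

theorem specProj_eq_iff {F G : Pt A} : specProj F = specProj G ↔ shadow F = shadow G :=
  Subtype.ext_iff

/-! ### Prime filters and their shadows -/

namespace Pt

variable {F G : Pt A} {a b c : A}

theorem mono (h : NatLE a b) (ha : F.1 a) : F.1 b := by
  rw [← inter_eq_of_natLE h, F.2.1.inter] at ha
  exact ha.2

theorem not_mem_of_meet_eq_zero (h : a ⊓ b = 0) (ha : F.1 a) : ¬ F.1 b := fun hb => by
  have := (F.2.1.inter a b).2 ⟨ha, hb⟩
  rw [inter_eq_zero h] at this
  exact F.2.1.zero this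

variable [RightHanded A]

theorem mem_or_mem_sdiff (a : A) (hb : F.1 b) : F.1 (a ⊓ b) ∨ F.1 (b \ a) := by
  rw [← sdiff_meet_inter_eq a b]
  exact F.2.1.prime _ _ hb

/-- The witness in the shadow may be any member of the filter: otherwise primeness would put `b \ a`
in `F`, and this is disjoint from every `a ⊓ c`. -/
theorem shadow_iff (hb : F.1 b) : shadow F a ↔ F.1 (a ⊓ b) := by
  refine (@decide_eq_true_iff _ (Classical.propDecidable _)).trans ⟨?_, fun h => ⟨b, hb, h⟩⟩
  rintro ⟨c, -, hac⟩
  refine (mem_or_mem_sdiff a hb).resolve_right fun h => ?_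
  refine not_mem_of_meet_eq_zero ?_ h hac
  rw [← meet_assoc, sdiff_meet_self, zero_meet]

theorem shadow_of_mem (h : F.1 a) : shadow F a := (shadow_iff h).2 (by rwa [meet_idem])

theorem mem_meet_iff : F.1 (a ⊓ b) ↔ shadow F a ∧ F.1 b := by
  constructor
  · intro h
    have hb := mono (meet_natLE_right a b) h
    exact ⟨(shadow_iff hb).2 h, hb⟩
  · rintro ⟨h, hb⟩
    exact (shadow_iff hb).1 h

theorem mem_sdiff_iff : F.1 (a \ b) ↔ F.1 a ∧ ¬ shadow F b := by
  constructor
  · intro h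
    have ha := mono (sdiff_natLE a b) h
    refine ⟨ha, fun hb => not_mem_of_meet_eq_zero ?_ h ((shadow_iff ha).1 hb)⟩
    exact sdiff_meet_right a b
  · rintro ⟨ha, hb⟩
    exact (mem_or_mem_sdiff b ha).resolve_left fun h => hb ((shadow_iff ha).2 h)

theorem mem_join_iff : F.1 (a ⊔ b) ↔ F.1 a ∨ (F.1 b ∧ ¬ shadow F a) := by
  constructor
  · intro h
    by_cases ha : shadow F a
    · rw [shadow_iff h, meet_join_absorb] at ha
      exact Or.inl ha
    · exact Or.inr ⟨mono (join_sdiff_natLE a b) (mem_sdiff_iff.2 ⟨h, ha⟩), ha⟩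
  · rintro (h | h)
    · exact mono (natLE_join_left a b) h
    · exact mono (sdiff_natLE_join a b) (mem_sdiff_iff.2 h)

theorem shadow_meet : shadow F (a ⊓ b) ↔ shadow F a ∧ shadow F b := by
  obtain ⟨c, hc⟩ := F.2.2
  rw [shadow_iff hc, meet_assoc, mem_meet_iff, shadow_iff (a := b) hc]

theorem shadow_mono (h : NatLE a b) (ha : shadow F a) : shadow F b := by
  rw [← h.1, shadow_meet] at ha
  exact ha.2

theorem shadow_prime (b : A) (ha : shadow F a) : shadow F b ∨ shadow F (a \ b) := by
  obtain ⟨c, hc⟩ := F.2.2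
  rw [shadow_iff hc, ← sdiff_join_right a b, join_meet_distrib, mem_join_iff, meet_assoc b,
    mem_meet_iff, mem_meet_iff] at ha
  tauto

theorem shadow_zero : ¬ shadow F 0 := by
  obtain ⟨c, hc⟩ := F.2.2
  rw [shadow_iff hc, zero_meet]
  exact F.2.1.zero

/-- Every element defined at the base point of `F` is in a prime filter over that base point. -/
theorem exists_shadow_eq (ha : shadow F a) : ∃ G : Pt A, G.1 a ∧ shadow G = shadow F := by
  have hself : ∀ c : A, c ∩ c = c := fun c => inter_eq_of_natLE (natLE_refl c)
  -- A filter containing `a` is determined by its shadow through this formula, so it is the only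
  -- possible candidate.
  have hpt : IsPrimeFilter fun c => shadow F (c ∩ a) := by
    refine ⟨?_, fun c d => ?_, fun c d hc => ?_⟩
    · rw [inter_eq_of_natLE (zero_natLE a)]
      exact shadow_zero
    · have h1 : (c ∩ d) ∩ a = (c ∩ a) ⊓ (d ∩ a) := by
        rw [meet_eq_inter (inter_le_right c a) (inter_le_right d a)]
        refine NatLE.antisymm (le_inter _ _ _ (le_inter _ _ _ ?_ ?_) (le_inter _ _ _ ?_ ?_))
          (le_inter _ _ _ (le_inter _ _ _ ?_ ?_) ?_)
        · exact (inter_le_left _ _).trans (inter_le_left _ _)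
        · exact inter_le_right _ _
        · exact (inter_le_left _ _).trans (inter_le_right _ _)
        · exact inter_le_right _ _
        · exact (inter_le_left _ _).trans (inter_le_left _ _)
        · exact (inter_le_right _ _).trans (inter_le_left _ _)
        · exact (inter_le_left _ _).trans (inter_le_right _ _)
      rw [h1, shadow_meet]
    · have hu := sdiff_natLE (c ∩ a) ((c ∩ a) ∩ d)
      refine (shadow_prime ((c ∩ a) ∩ d) hc).imp (fun h => ?_) fun h => ?_
      · exact shadow_mono (le_inter _ _ _ (inter_le_right _ _)
          ((inter_le_left _ _).trans (inter_le_right _ _))) h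
      · refine shadow_mono (le_inter _ _ _ (natLE_sdiff_inter (hu.trans (inter_le_left _ _)) ?_)
          (hu.trans (inter_le_right _ _))) h
        exact eq_zero_of_natLE (inter_le_left _ _)
          (le_inter _ _ _ ((inter_le_left _ _).trans hu) (inter_le_right _ _))
          (sdiff_meet_self _ _)
  have ha' : shadow F (a ∩ a) := by rwa [hself]
  refine ⟨⟨_, hpt, a, ha'⟩, ha', ?_⟩
  funext x
  rw [Bool.eq_iff_iff, shadow_iff (F := ⟨_, hpt, a, ha'⟩) (b := a) ha']
  change shadow F ((x ⊓ a) ∩ a) ↔ _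
  rw [inter_eq_of_natLE (meet_natLE_right x a), shadow_meet]
  exact and_iff_left ha

theorem eq_of_shadow_eq (hF : F.1 a) (hG : G.1 a) (h : shadow F = shadow G) : F = G := by
  have key : ∀ {F G : Pt A}, F.1 a → G.1 a → shadow F = shadow G → ∀ c, F.1 c → G.1 c := by
    intro F G hF hG h c hc
    have h1 : shadow F (c ∩ a) := shadow_of_mem ((F.2.1.inter c a).2 ⟨hc, hF⟩)
    rw [h, shadow_iff hG, (inter_le_right c a).1, G.2.1.inter] at h1
    exact h1.1
  refine Subtype.ext (funext fun c => ?_)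
  rw [Bool.eq_iff_iff]
  exact ⟨key hF hG h c, key hG hF h.symm c⟩

/-- A basic neighborhood fixes finitely many coordinates. Starting from a member `a` of `F`, a
positive condition at `i` is absorbed by `a ∩ i` and a negative one by `a \ (a ∩ i)`, which
primeness puts in `F`. -/
theorem exists_cyl_subset {U : Set (Pt A)} (hU : IsOpen U) (hF : F ∈ U) :
    ∃ a, F ∈ cyl a ∧ cyl a ⊆ U := by
  obtain ⟨V, hV, rfl⟩ := isOpen_induced_iff.1 hU
  obtain ⟨I, u, hu, huV⟩ := isOpen_pi_iff.1 hV F.1 hF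
  suffices h : ∀ I : Finset A, ∃ a, F.1 a ∧ ∀ G : Pt A, G.1 a → ∀ i ∈ I, G.1 i = F.1 i by
    obtain ⟨a, ha, h⟩ := h I
    refine ⟨a, ha, fun G hG => huV fun i hi => ?_⟩
    rw [h G hG i hi]
    exact (hu i hi).2
  classical
  intro I
  induction I using Finset.induction_on with
  | empty =>
    obtain ⟨a, ha⟩ := F.2.2
    exact ⟨a, ha, fun _ _ _ h => absurd h (Finset.notMem_empty _)⟩
  | insert i I _ ih =>
    obtain ⟨a, ha, h⟩ := ih
    by_cases hi : F.1 i
    · refine ⟨a ∩ i, (F.2.1.inter _ _).2 ⟨ha, hi⟩, fun G hG j hj => ?_⟩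
      rw [G.2.1.inter] at hG
      rcases Finset.mem_insert.1 hj with rfl | hj
      · rw [hG.2, hi]
      · exact h G hG.1 j hj
    · refine ⟨a \ (a ∩ i), (F.2.1.prime a i ha).resolve_left hi, fun G hG j hj => ?_⟩
      have hGa := mono (sdiff_natLE _ _) hG
      rcases Finset.mem_insert.1 hj with rfl | hj
      · rw [Bool.eq_iff_iff]
        refine ⟨fun hGj => absurd ((G.2.1.inter _ _).2 ⟨hGa, hGj⟩) ?_, fun h => absurd h hi⟩
        exact not_mem_of_meet_eq_zero (sdiff_meet_self _ _) hG
      · exact h G hGa j hj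

/-- A nonzero element belongs to some prime filter. -/
theorem exists_mem (ha : a ≠ 0) : ∃ F : Pt A, F.1 a := by
  let P : Set (Set A) := {S | 0 ∉ S ∧ (∀ x ∈ S, ∀ y ∈ S, x ∩ y ∈ S) ∧
    ∀ x ∈ S, ∀ y, NatLE x y → y ∈ S}
  have h0 : {y | NatLE a y} ∈ P :=
    ⟨fun h => ha (natLE_zero_iff.1 h), fun x hx y hy => le_inter _ _ _ hx hy,
      fun x hx y hxy => NatLE.trans hx hxy⟩
  obtain ⟨M, haM, hM⟩ := zorn_subset_nonempty P (by
    intro C hC hchain hne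
    refine ⟨⋃₀ C, ⟨?_, ?_, ?_⟩, fun s hs => Set.subset_sUnion_of_mem hs⟩
    · rintro ⟨S, hS, h⟩
      exact (hC hS).1 h
    · rintro x ⟨S, hS, hx⟩ y ⟨T, hT, hy⟩
      rcases hchain.total hS hT with h | h
      · exact ⟨T, hT, (hC hT).2.1 x (h hx) y hy⟩
      · exact ⟨S, hS, (hC hS).2.1 x hx y (h hy)⟩
    · rintro x ⟨S, hS, hx⟩ y hxy
      exact ⟨S, hS, (hC hS).2.2 x hx y hxy⟩) _ h0
  obtain ⟨⟨hM0, hMi, hMu⟩, hmax⟩ := hM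
  have hprime : ∀ x ∈ M, ∀ y, y ∈ M ∨ x \ (x ∩ y) ∈ M := by
    intro x hx y
    -- Either some member of `M` is disjoint from `y`, and its intersection with `x` lies below `x \
    -- (x ∩ y)`; or `M` and `y` generate a proper filter, and maximality puts `y` in `M`.
    by_cases h : ∃ c ∈ M, c ∩ y = 0
    · obtain ⟨c, hc, hcy⟩ := h
      right
      refine hMu _ (hMi c hc x hx) _ (natLE_sdiff_inter (inter_le_right c x) ?_)
      rw [← natLE_zero_iff, ← hcy]
      exact le_inter _ _ _ ((inter_le_left _ _).trans (inter_le_left _ _)) (inter_le_right _ _)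
    · left
      push Not at h
      have hN : {d | ∃ c ∈ M, NatLE (c ∩ y) d} ∈ P := by
        refine ⟨?_, ?_, ?_⟩
        · rintro ⟨c, hc, h'⟩
          exact h c hc (natLE_zero_iff.1 h')
        · rintro d ⟨c, hc, hd⟩ d' ⟨c', hc', hd'⟩
          refine ⟨c ∩ c', hMi c hc c' hc', le_inter _ _ _ (NatLE.trans (le_inter _ _ _ ?_ ?_) hd)
            (NatLE.trans (le_inter _ _ _ ?_ ?_) hd')⟩
          · exact (inter_le_left _ _).trans (inter_le_left _ _)
          · exact inter_le_right _ _
          · exact (inter_le_left _ _).trans (inter_le_right _ _)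
          · exact inter_le_right _ _
        · rintro d ⟨c, hc, hd⟩ d' hdd'
          exact ⟨c, hc, hd.trans hdd'⟩
      exact hmax hN (fun c hc => ⟨c, hc, inter_le_left c y⟩) ⟨x, hx, inter_le_right x y⟩
  classical
  have haM' : a ∈ M := haM (natLE_refl a)
  refine ⟨⟨fun x => decide (x ∈ M), ⟨?_, fun x y => ?_, fun x y hx => ?_⟩, a, by simpa using haM'⟩,
    by simpa using haM'⟩
  · simpa using hM0
  · simp only [decide_eq_true_eq]
    exact ⟨fun h => ⟨hMu _ h _ (inter_le_left x y), hMu _ h _ (inter_le_right x y)⟩,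
      fun h => hMi x h.1 y h.2⟩
  · simp only [decide_eq_true_eq] at hx ⊢
    exact hprime x hx y

theorem natLE_of_forall_mem (h : ∀ F : Pt A, F.1 a → F.1 b) : NatLE a b := by
  have h0 : a \ (a ∩ b) = 0 := by
    by_contra hne
    obtain ⟨F, hF⟩ := exists_mem hne
    have ha := mono (sdiff_natLE _ _) hF
    exact not_mem_of_meet_eq_zero (sdiff_meet_self _ _) hF ((F.2.1.inter a b).2 ⟨ha, h F ha⟩)
  have := sdiff_join_of_natLE (inter_le_left a b)
  rw [h0, zero_join] at this
  rw [← this]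
  exact inter_le_right a b

end Pt

/-! ### The étale projection and the representation by sections -/

variable [RightHanded A]

/-- On the open cylinder of `b`, the coordinate of the shadow at `a` is evaluation at `a ⊓ b`. -/
theorem continuous_shadow : Continuous (shadow : Pt A → A → Bool) := by
  refine continuous_pi fun a => continuous_iff_continuousAt.2 fun F => ?_
  obtain ⟨b, hb⟩ := F.2.2
  have h1 : ContinuousAt (fun G : Pt A => G.1 (a ⊓ b)) F :=
    ((continuous_apply (a ⊓ b)).comp continuous_subtype_val).continuousAt
  refine h1.congr ?_
  filter_upwards [(isOpen_cyl b).mem_nhds hb] with G hG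
  rw [Bool.eq_iff_iff]
  exact (Pt.shadow_iff hG).symm

theorem continuous_specProj : Continuous (specProj : Pt A → BasePt A) :=
  continuous_shadow.subtype_mk _

theorem specProj_image_cyl (a : A) : specProj '' cyl a = {P : BasePt A | P.1 a = true} := by
  ext P
  obtain ⟨F, rfl⟩ := specProj_surjective P
  constructor
  · rintro ⟨G, hG, h⟩
    rw [← h]
    exact Pt.shadow_of_mem hG
  · intro h
    obtain ⟨G, hG, hGF⟩ := Pt.exists_shadow_eq (F := F) (a := a) h
    exact ⟨G, hG, specProj_eq_iff.2 hGF⟩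

theorem isOpenMap_specProj : IsOpenMap (specProj : Pt A → BasePt A) := by
  intro U hU
  rw [isOpen_iff_forall_mem_open]
  rintro _ ⟨F, hF, rfl⟩
  obtain ⟨a, ha, haU⟩ := Pt.exists_cyl_subset hU hF
  refine ⟨specProj '' cyl a, Set.image_mono haU, ?_, ⟨F, ha, rfl⟩⟩
  rw [specProj_image_cyl]
  exact (isClopen_eval a).isOpen.preimage continuous_subtype_val

theorem injOn_specProj_cyl (a : A) : Set.InjOn specProj (cyl a) :=
  fun _ hF _ hG h => Pt.eq_of_shadow_eq hF hG (specProj_eq_iff.1 h)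

instance : BooleanSpace (BasePt A) :=
  .of_isEmbedding (φ := Subtype.val) Topology.IsEmbedding.subtypeVal
    (fun a => specProj_image_cyl a ▸ (isCompact_cyl a).image continuous_specProj) fun P => by
      obtain ⟨F, rfl⟩ := specProj_surjective P
      obtain ⟨a, ha⟩ := F.2.2
      exact ⟨a, Pt.shadow_of_mem ha⟩

theorem isLocalHomeomorph_specProj : IsLocalHomeomorph (specProj : Pt A → BasePt A) := by
  rw [isLocalHomeomorph_iff_isOpenEmbedding_restrict]
  intro F
  obtain ⟨a, ha⟩ := F.2.2
  refine ⟨cyl a, (isOpen_cyl a).mem_nhds ha, .of_continuous_injective_isOpenMap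
    (continuous_specProj.comp continuous_subtype_val)
    (Set.injOn_iff_injective.1 (injOn_specProj_cyl a)) ?_⟩
  exact isOpenMap_specProj.comp (isOpen_cyl a).isOpenMap_subtype_val

variable (A) in
/-- The spectrum of a right-handed skew algebra. -/
noncomputable def spec : SkewBooleanSpace.{u} where
  total := Pt A
  base := BasePt A
  proj := specProj
  etale := isLocalHomeomorph_specProj
  surj := specProj_surjective

/-- The copen section of the spectrum defined by an element. -/
def cylSection (a : A) : CopenSection (spec A) where
  carrier := cyl a
  isOpen := isOpen_cyl a
  isCompact := isCompact_cyl a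
  inj := injOn_specProj_cyl a

theorem mem_sat_cyl {a : A} {F : Pt A} : F ∈ sat (spec A) (cyl a) ↔ shadow F a = true := by
  change specProj F ∈ specProj '' cyl a ↔ _
  rw [specProj_image_cyl]
  rfl

variable (A) in
/-- The representation of a right-handed skew algebra by copen sections of its spectrum. -/
def toSections : SkewHom A (CopenSection (spec A)) where
  toFun := cylSection
  map_zero := CopenSection.ext_mem fun F => iff_of_false F.2.1.zero id
  map_meet _ _ := CopenSection.ext_mem fun _ =>
    Pt.mem_meet_iff.trans (and_congr_left' mem_sat_cyl.symm)
  map_join _ _ := CopenSection.ext_mem fun _ =>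
    Pt.mem_join_iff.trans (or_congr_right (and_congr_right' (not_congr mem_sat_cyl.symm)))
  map_sdiff _ _ := CopenSection.ext_mem fun _ =>
    Pt.mem_sdiff_iff.trans (and_congr_right' (not_congr mem_sat_cyl.symm))
  map_inter a b := CopenSection.ext_mem fun F => F.2.1.inter a b

theorem toSections_injective : Function.Injective (toSections A).toFun := fun a b h => by
  have h' : ∀ F : Pt A, F.1 a = true ↔ F.1 b = true := fun F =>
    Set.ext_iff.1 (congrArg CopenSection.carrier h) F
  exact (Pt.natLE_of_forall_mem fun F => (h' F).1).antisymm
    (Pt.natLE_of_forall_mem fun F => (h' F).2)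

theorem toSections_surjective : Function.Surjective (toSections A).toFun := fun S => by
  obtain ⟨a, h1, h2⟩ : ∃ a : A, cyl a ⊆ S.carrier ∧ S.carrier ⊆ cyl a := by
    refine S.isCompact.induction_on (p := fun s => ∃ a : A, cyl a ⊆ S.carrier ∧ s ⊆ cyl a)
      ⟨0, fun F hF => (F.2.1.zero hF).elim, Set.empty_subset _⟩ ?_ ?_ ?_
    · rintro s t hst ⟨a, h1, h2⟩
      exact ⟨a, h1, hst.trans h2⟩
    · rintro s t ⟨a, h1, h2⟩ ⟨b, h3, h4⟩
      refine ⟨a ⊔ b, fun F hF => ?_, ?_⟩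
      · rcases Pt.mem_join_iff.1 hF with h | h
        · exact h1 h
        · exact h3 h.1
      · rintro F (hF | hF)
        · exact Pt.mem_join_iff.2 (Or.inl (h2 hF))
        -- The cylinder of `a ⊔ b` drops the points of `cyl b` lying over the base of `cyl a`.
        -- Nothing is lost: both cylinders lie in the section `S`, so such a point already belongs
        -- to `cyl a`.
        · by_cases h : shadow F a
          · obtain ⟨G, hG, hGF⟩ := mem_sat_cyl.2 h
            have : G = F := S.inj (h1 hG) (h3 (h4 hF)) hGF
            exact Pt.mem_join_iff.2 (Or.inl (this ▸ hG))
          · exact Pt.mem_join_iff.2 (Or.inr ⟨h4 hF, h⟩)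
    · intro F hF
      obtain ⟨a, ha, haS⟩ := Pt.exists_cyl_subset S.isOpen hF
      exact ⟨cyl a, mem_nhdsWithin_of_mem_nhds ((isOpen_cyl a).mem_nhds ha), a, haS, subset_rfl⟩
  exact ⟨a, CopenSection.ext (h1.antisymm h2)⟩

end Spectrum

/-- A bijective homomorphism is an isomorphism. -/
noncomputable def isoOfBijective {A B : RightSkewAlg.{u}} (f : A ⟶ B)
    (hf : Function.Bijective (mapOf f)) : A ≅ B :=
  let e := Equiv.ofBijective _ hf
  have key : ∀ x, SkewHom.toFun f (e.symm x) = x := e.apply_symm_apply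
  have inj : Function.Injective (SkewHom.toFun f) := hf.1
  { hom := f
    inv :=
      { toFun := e.symm
        map_zero := inj (by rw [key, SkewHom.map_zero f])
        map_meet := fun x y => inj (by rw [SkewHom.map_meet f, key, key, key])
        map_join := fun x y => inj (by rw [SkewHom.map_join f, key, key, key])
        map_sdiff := fun x y => inj (by rw [SkewHom.map_sdiff f, key, key, key])
        map_inter := fun x y => inj (by rw [SkewHom.map_inter f, key, key, key]) }
    hom_inv_id := SkewHom.ext (funext fun x => e.symm_apply_apply x)
    inv_hom_id := SkewHom.ext (funext fun x => e.apply_symm_apply x) }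

instance : sectionFunctor.{u}.EssSurj where
  mem_essImage A := ⟨op (spec A.carrier), ⟨(isoOfBijective
    (B := sectionFunctor.obj (op (spec A.carrier))) (toSections A.carrier)
    ⟨toSections_injective, toSections_surjective⟩).symm⟩⟩

instance : sectionFunctor.{u}.IsEquivalence where

/-! ## Cofinality and semitotality -/

open SkewLattice SkewBooleanAlgebra in
theorem isIdeal_natPre {A A' : RightSkewAlg.{u}} (f : A ⟶ A') :
    IsIdeal {y : A'.carrier | ∃ x : A.carrier, NatPre y (mapOf f x)} where
  zero_mem := ⟨0, by rw [NatPre, zero_meet, zero_meet]⟩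
  join_mem := by
    rintro y z ⟨a, ha⟩ ⟨b, hb⟩
    refine ⟨a ⊔ b, ?_⟩
    rw [show mapOf f (a ⊔ b) = mapOf f a ⊔ mapOf f b from SkewHom.map_join f a b]
    rw [NatPre, meet_meet_self] at ha hb ⊢
    have h : ∀ u v : A'.carrier, u ⊔ (v ⊓ u) = u := fun u v => by
      rw [← meet_meet_self, meet_assoc, join_meet_absorb]
    rw [meet_join_distrib, join_meet_distrib, join_meet_distrib, ha, hb, h, meet_join_absorb']
  lower := fun _ _ h ⟨a, ha⟩ => ⟨a, natPre_trans h ha⟩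

theorem preCofinal_iff {A A' : RightSkewAlg.{u}} (f : A ⟶ A') :
    preCofinal f ↔ ∀ y : A'.carrier, ∃ x : A.carrier, NatPre y (mapOf f x) := by
  constructor
  · intro h y
    have hy : y ∈ idealSpan (Set.range (mapOf f)) :=
      (show idealSpan (Set.range (mapOf f)) = Set.univ from h) ▸ Set.mem_univ y
    refine hy _ (isIdeal_natPre f) ?_
    rintro _ ⟨x, rfl⟩
    exact ⟨x, by rw [NatPre, SkewLattice.meet_idem, SkewLattice.meet_idem]⟩
  · refine fun h => Set.eq_univ_of_forall fun y I hI hf => ?_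
    obtain ⟨x, hx⟩ := h y
    exact hI.lower _ _ hx (hf ⟨x, rfl⟩)

theorem isomorphisms_le_preCofinal :
    MorphismProperty.isomorphisms RightSkewAlg.{u} ≤ preCofinal := by
  intro A B f (hf : IsIso f)
  have hs : Set.range (mapOf f) = Set.univ := Set.eq_univ_of_forall fun y =>
    ⟨mapOf (inv f) y, congrFun (congrArg SkewHom.toFun (IsIso.inv_hom_id f)) y⟩
  exact Set.eq_univ_of_forall fun y I _ h => h (hs ▸ Set.mem_univ y)

theorem semitotal_iff_preCofinal {X Y : SkewBooleanSpace.{u}} (a : X ⟶ Y) :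
    semitotal a ↔ preCofinal (sectionFunctor.{u}.map a.op) :=
  (semitotal_iff a).trans (preCofinal_iff (sectionFunctor.{u}.map a.op)).symm

/-! ## Restricting a dual equivalence to wide subcategories -/

section Restrict

universe v₁ v₂ u₁ u₂

variable {C : Type u₁} [Category.{v₁} C] {D : Type u₂} [Category.{v₂} D] (E : Cᵒᵖ ≌ D)
  {P : MorphismProperty C} {Q : MorphismProperty D} [Q.IsMultiplicative]

/-- Applying the functor to the image of `f` under the inverse gives `f` conjugated by counit
isomorphisms, and `Q` is invariant under composition with isomorphisms. -/
theorem iff_inverse_of_iff_functor (hP : ∀ {X Y : C} (a : X ⟶ Y), P a ↔ Q (E.functor.map a.op))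
    (hQ : MorphismProperty.isomorphisms D ≤ Q) {A B : D} (f : A ⟶ B) :
    Q f ↔ P (E.inverse.map f).unop := by
  have : Q.RespectsIso := MorphismProperty.respectsIso_of_isStableUnderComposition hQ
  rw [hP, Quiver.Hom.op_unop, E.fun_inv_map, Q.cancel_left_of_respectsIso,
    Q.cancel_right_of_respectsIso]

variable [P.IsMultiplicative]

/-- A dual equivalence restricts to the wide subcategories of corresponding classes of morphisms
which contain the isomorphisms. -/
def restrictWide (hP : ∀ {X Y : C} (a : X ⟶ Y), P a ↔ Q (E.functor.map a.op))
    (hQ : MorphismProperty.isomorphisms D ≤ Q) : (WideSubcategory P)ᵒᵖ ≌ WideSubcategory Q :=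
  have hP' : ∀ {X Y : C} (a : X ⟶ Y) [IsIso a], P a := fun a _ =>
    (hP a).2 (hQ _ (MorphismProperty.isomorphisms.infer_property _))
  -- Both functors act by the data of `E` itself, and only the unit is adjusted for the triangle
  -- identity; compatibility with the inclusions is therefore definitional.
  CategoryTheory.Equivalence.mk
    { obj := fun X => ⟨E.functor.obj (op X.unop.obj)⟩
      map := fun a => ⟨E.functor.map a.unop.hom.op, (hP _).1 a.unop.property⟩
      map_id := fun _ => WideSubcategory.hom_ext _ (E.functor.map_id _)
      map_comp := fun a b => WideSubcategory.hom_ext _ 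
        (E.functor.map_comp a.unop.hom.op b.unop.hom.op) }
    { obj := fun A => op ⟨(E.inverse.obj A.obj).unop⟩
      map := fun f => Quiver.Hom.op
        ⟨(E.inverse.map f.hom).unop, (iff_inverse_of_iff_functor E hP hQ _).1 f.property⟩
      map_id := fun A => Quiver.Hom.unop_inj <| WideSubcategory.hom_ext _ <|
        congrArg Quiver.Hom.unop (E.inverse.map_id A.obj)
      map_comp := fun f g => Quiver.Hom.unop_inj <| WideSubcategory.hom_ext _ <|
        congrArg Quiver.Hom.unop (E.inverse.map_comp f.hom g.hom) }
    (NatIso.ofComponents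
      (fun X => (WideSubcategory.isoMk (X := ⟨(E.inverse.obj (E.functor.obj (op X.unop.obj))).unop⟩)
        (Y := X.unop) (E.unitIso.app (op X.unop.obj)).unop (hP' _) (hP' _)).op)
      fun a => Quiver.Hom.unop_inj <| WideSubcategory.hom_ext _ <|
        congrArg Quiver.Hom.unop (E.unitIso.hom.naturality a.unop.hom.op))
    (NatIso.ofComponents
      (fun A => WideSubcategory.isoMk (X := ⟨E.functor.obj (E.inverse.obj A.obj)⟩)
        (Y := A) (E.counitIso.app A.obj)
        (hQ _ (MorphismProperty.isomorphisms.infer_property _))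
        (hQ _ (MorphismProperty.isomorphisms.infer_property _)))
      fun f => WideSubcategory.hom_ext _ (E.counitIso.hom.naturality f.hom))

end Restrict

end SkewDuality

theorem mainTheorem9 :
    (sectionFunctor.{u}).IsEquivalence ∧
    (∀ {A A' : RightSkewAlg.{u}} (f : A ⟶ A'),
      preCofinal f ↔ ∀ y : A'.carrier, ∃ x : A.carrier, NatPre y (mapOf f x)) ∧
    ∀ D : SkewBooleanSpace.{u}ᵒᵖ ≌ RightSkewAlg.{u}, D.functor = sectionFunctor.{u} →
      (∀ {X Y : SkewBooleanSpace.{u}} (a : X ⟶ Y),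
        semitotal a ↔ preCofinal (D.functor.map a.op)) ∧
      (∀ {A A' : RightSkewAlg.{u}} (f : A ⟶ A'),
        preCofinal f ↔ semitotal (D.inverse.map f).unop) ∧
      ∃ D' : (WideSubcategory semitotal.{u})ᵒᵖ ≌ WideSubcategory preCofinal.{u},
        D'.functor ⋙ wideSubcategoryInclusion preCofinal.{u} =
          (wideSubcategoryInclusion semitotal.{u}).op ⋙ D.functor ∧
        D'.inverse ⋙ (wideSubcategoryInclusion semitotal.{u}).op =
          wideSubcategoryInclusion preCofinal.{u} ⋙ D.inverse := by
  refine ⟨inferInstance, preCofinal_iff, fun D hD => ?_⟩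
  have h1 : ∀ {X Y : SkewBooleanSpace.{u}} (a : X ⟶ Y),
      semitotal a ↔ preCofinal (D.functor.map a.op) := fun a => by
    rw [hD]
    exact semitotal_iff_preCofinal a
  exact ⟨h1, iff_inverse_of_iff_functor D h1 isomorphisms_le_preCofinal,
    restrictWide D h1 isomorphisms_le_preCofinal, rfl, rfl⟩
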